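/- Let $n\ge 1$, let $\mathcal X$ be a measurable space and let $f:\mathcal X^n\to\mathbb R$ be bounded and measurable. For $k\in\{1,\dots,n\}$ and $y,y'\in\mathcal X$ put $$D^k_{y,y'}f(\mathbf x)=f(x_1,\dots,x_{k-1},y,x_{k+1},\dots,x_n)-f(x_1,\dots,x_{k-1},y',x_{k+1},\dots,x_n),$$ $$M(f)=\max_{k}\ \sup_{\mathbf x\in\mathcal X^n,\ y,y'\in\mathcal X}D^k_{y,y'}f(\mathbf x),\qquad J(f)=n\max_{l\neq k}\ \sup_{\mathbf x\in\mathcal X^n,\ z,z',y,y'\in\mathcal X}D^l_{z,z'}D^k_{y,y'}f(\mathbf x)$$ (with $J(f)=0$ if $n=1$). Suppose that $f$ has $(a,b)$-weak interactions, that is, $M(f)\le a/n$ and $J(f)\le b/n$ for real numbers $a,b$ (which are then necessarily non-negative). For $\mathbf x=(x_1,\dots,x_{n+1})\in\mathcal X^{n+1}$ and $j\in\{1,\dots,n+1\}$ let $S^j_-\mathbf x\in\mathcal X^n$ be $\mathbf x$ with its $j$-th component deleted, let $S^i_{y}\mathbf x\in\mathcal X^{n+1}$ be $\mathbf x$ with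 its $i$-th component replaced by $y$, and let $$v_f(\mathbf x)=\frac{1}{2(n+1)}\sum_{j=1}^{n+1}\ \sum_{i:\,i\ne j}\bigl(f(S^j_-\mathbf x)-f(S^j_-S^i_{x_j}\mathbf x)\bigr)^2 .$$ Let $X_1,\dots,X_{n+1}$ be independent and identically distributed random variables with values in $\mathcal X$, let $\mathbf X=(X_1,\dots,X_{n+1})$, and write $f(\mathbf X)=f(X_1,\dots,X_n)$ and $E[f]=E[f(X_1,\dots,X_n)]$. Then for every $\delta>0$, with probability at least $1-\delta$, $$f(\mathbf X)\le E[f]+\sqrt{2\,v_f(\mathbf X)\ln(2/\delta)}+\frac{(8a/3+5b)\ln(2/\delta)}{n}.$$ (For $\delta\ge 1$ the assertion is trivial.) -/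

import Mathlib

open MeasureTheory ProbabilityTheory

namespace WeakInteractions

noncomputable section

/-- The partial difference operator: `partialDiff k y y' f x` is `f` at `x` with the `k`-th
coordinate set to `y`, minus `f` at `x` with the `k`-th coordinate set to `y'`. -/
def partialDiff {n : ℕ} {𝒳 : Type*} (k : Fin n) (y y' : 𝒳) (f : (Fin n → 𝒳) → ℝ) :
    (Fin n → 𝒳) → ℝ :=
  fun x => f (Function.update x k y) - f (Function.update x k y')

/-- The seminorm `M(f)`, for bounded `f`: the maximum over `k` of the supremum over all
`x, y, y'` of the first partial differences. -/
def seminormM {n : ℕ} {𝒳 : Type*} (f : (Fin n → 𝒳) → ℝ) : ℝ :=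
  ⨆ k : Fin n, ⨆ q : (Fin n → 𝒳) × 𝒳 × 𝒳, partialDiff k q.2.1 q.2.2 f q.1

/-- The seminorm `J(f)`, for bounded `f`: `n` times the maximum over pairs `l ≠ k` of the
supremum over all `x, z, z', y, y'` of the mixed second partial differences.
If `n = 1` there is no such pair and `J(f) = 0`. -/
def seminormJ {n : ℕ} {𝒳 : Type*} (f : (Fin n → 𝒳) → ℝ) : ℝ :=
  (n : ℝ) * ⨆ p : {p : Fin n × Fin n // p.1 ≠ p.2},
    ⨆ q : (Fin n → 𝒳) × (𝒳 × 𝒳) × (𝒳 × 𝒳),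
      partialDiff p.1.1 q.2.1.1 q.2.1.2 (partialDiff p.1.2 q.2.2.1 q.2.2.2 f) q.1

/-- `f` has `(a, b)`-weak interactions. -/
def HasWeakInteractions {n : ℕ} {𝒳 : Type*} (a b : ℝ) (f : (Fin n → 𝒳) → ℝ) : Prop :=
  seminormM f ≤ a / n ∧ seminormJ f ≤ b / n

/-- The variance estimator `v_f`, a function of `n + 1` observations. Here `j.removeNth x` is `x`
with the `j`-th coordinate deleted, and `Function.update x i (x j)` is `x` with its `i`-th
coordinate replaced by its `j`-th one. -/
def varEstimator {n : ℕ} {𝒳 : Type*} (f : (Fin n → 𝒳) → ℝ) (x : Fin (n + 1) → 𝒳) : ℝ :=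
  1 / (2 * ((n : ℝ) + 1)) *
    ∑ j : Fin (n + 1), ∑ i ∈ Finset.univ.filter (fun i : Fin (n + 1) => i ≠ j),
      (f (j.removeNth x) - f (j.removeNth (Function.update x i (x j)))) ^ 2

end

end WeakInteractions

/-!
The proof is by the entropy method. Bernstein's inequality for functions with weak interactions
controls `f - E[f]` in terms of `V`, the expected sum of the conditional variances of `f`. The
estimator `v_f` is unbiased for `V` (`integral_varEstimator`), so it remains to control the lower
tail of `√(v_f)` and to spend `δ / 2` on each of the two events.

The common tool is the subadditivity of entropy for product measures (`ent_pi_le_sum`), together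
with the one-dimensional bound `Ent(e^g) ≤ E[e^g (e^(c - g) - (c - g) - 1)]`, valid for every
constant `c` (`ent_le_integral`). Herbst's argument (`mul_cgf_sub_le_integral`) turns entropy
bounds into bounds for the log-Laplace transform.

* *Self-bounding functions.* If changing the coordinate `k` decreases `Z` by at most `r k` and
  `∑ (r k)² ≤ C Z`, then choosing for `c` the extremal value over the coordinate `k` bounds the
  log-Laplace transform of `Z`, both at positive and at negative arguments. If also
  `r k ≤ C`, then at negative arguments the bound is the one of a Poisson variable, whence
  `√(E[Z]) ≤ √Z + √(C L)` up to probability `exp (-L)` (`SelfBounding.measure_sqrt_add_lt_le`).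
* *Bernstein's inequality* (`measure_bernstein_le`). With `c` the conditional mean,
  `Ent(e^(t f)) ≤ κ(t) E[S e^(t f)]`, where `S` is the sum of the conditional variances. Since the
  mixed second differences of `f` are small, `S` is self-bounding, and the Gibbs variational
  inequality decouples `S` from `e^(t f)`. The result is sub-gamma with scale `M / 3 + J'` for every
  positive `J' ≥ J`.
* *The estimator* is self-bounding with `C = 2 (M + 2 J)²` (`selfBounding_varEstimator`): changing
  `x k` removes at most the squared differences involving `k`, and alters each other difference by
  a mixed second difference of `f`. Hence `√(2 V L) ≤ √(2 v_f L) + 2 (M + 2 J) L`, which with the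
  linear term `(2 M / 3 + J) L` of Bernstein's inequality adds up to `(8 M / 3 + 5 J) L`.
-/

namespace WeakInteractions

open Filter Topology

/-! ### Bounded measurable functions -/

/-- Bounded measurable real functions. Every integral below is taken of such a function with
respect to a finite measure, so that integrability is never an issue. -/
structure BddMeas {α : Type*} [MeasurableSpace α] (g : α → ℝ) : Prop where
  meas : Measurable g
  bdd : ∃ C, ∀ x, |g x| ≤ C

namespace BddMeas

variable {α β : Type*} [MeasurableSpace α] [MeasurableSpace β] {g h : α → ℝ}

theorem const (c : ℝ) : BddMeas (fun _ : α => c) := ⟨measurable_const, |c|, fun _ => le_rfl⟩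

theorem add (hg : BddMeas g) (hh : BddMeas h) : BddMeas (fun x => g x + h x) := by
  obtain ⟨C, hC⟩ := hg.bdd
  obtain ⟨D, hD⟩ := hh.bdd
  exact ⟨hg.meas.add hh.meas, C + D, fun x => (abs_add_le _ _).trans (add_le_add (hC x) (hD x))⟩

theorem neg (hg : BddMeas g) : BddMeas (fun x => - g x) := by
  obtain ⟨C, hC⟩ := hg.bdd
  exact ⟨hg.meas.neg, C, fun x => by rw [abs_neg]; exact hC x⟩

theorem sub (hg : BddMeas g) (hh : BddMeas h) : BddMeas (fun x => g x - h x) := by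
  simpa only [sub_eq_add_neg] using hg.add hh.neg

theorem mul (hg : BddMeas g) (hh : BddMeas h) : BddMeas (fun x => g x * h x) := by
  obtain ⟨C, hC⟩ := hg.bdd
  obtain ⟨D, hD⟩ := hh.bdd
  refine ⟨hg.meas.mul hh.meas, C * D, fun x => ?_⟩
  rw [abs_mul]
  exact mul_le_mul (hC x) (hD x) (abs_nonneg _) ((abs_nonneg _).trans (hC x))

theorem const_mul (hg : BddMeas g) (c : ℝ) : BddMeas (fun x => c * g x) := (const c).mul hg

theorem sq (hg : BddMeas g) : BddMeas (fun x => g x ^ 2) := by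
  simpa only [pow_two] using hg.mul hg

theorem abs (hg : BddMeas g) : BddMeas (fun x => |g x|) := by
  obtain ⟨C, hC⟩ := hg.bdd
  exact ⟨hg.meas.abs, C, fun x => by rw [abs_abs]; exact hC x⟩

theorem exp (hg : BddMeas g) : BddMeas (fun x => Real.exp (g x)) := by
  obtain ⟨C, hC⟩ := hg.bdd
  refine ⟨hg.meas.exp, Real.exp C, fun x => ?_⟩
  rw [Real.abs_exp]
  exact Real.exp_le_exp.2 ((le_abs_self _).trans (hC x))

theorem sqrt (hg : BddMeas g) : BddMeas (fun x => √(g x)) := by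
  obtain ⟨C, hC⟩ := hg.bdd
  refine ⟨hg.meas.sqrt, √C, fun x => ?_⟩
  rw [abs_of_nonneg (Real.sqrt_nonneg _)]
  exact Real.sqrt_le_sqrt ((le_abs_self _).trans (hC x))

theorem sum {ι : Type*} {s : Finset ι} {u : ι → α → ℝ} (hu : ∀ i, BddMeas (u i)) :
    BddMeas (fun x => ∑ i ∈ s, u i x) := by
  classical
  induction s using Finset.induction_on with
  | empty => simpa using const (α := α) 0
  | insert a s ha ih => simpa only [Finset.sum_insert ha] using (hu a).add ih

theorem comp (hg : BddMeas g) {T : β → α} (hT : Measurable T) : BddMeas (fun x => g (T x)) := by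
  obtain ⟨C, hC⟩ := hg.bdd
  exact ⟨hg.meas.comp hT, C, fun x => hC _⟩

theorem integrable (hg : BddMeas g) (μ : Measure α) [IsFiniteMeasure μ] : Integrable g μ := by
  obtain ⟨C, hC⟩ := hg.bdd
  exact Integrable.of_bound hg.meas.aestronglyMeasurable C
    (Filter.Eventually.of_forall fun x => by rw [Real.norm_eq_abs]; exact hC x)

theorem abs_integral_le {μ : Measure α} [IsProbabilityMeasure μ] {C : ℝ} (hC : ∀ x, |g x| ≤ C) :
    |∫ x, g x ∂μ| ≤ C := by
  have := norm_integral_le_of_norm_le_const (μ := μ) (f := g) (C := C)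
    (Filter.Eventually.of_forall fun x => by rw [Real.norm_eq_abs]; exact hC x)
  simpa using this

theorem integral_right {F : α × β → ℝ} (hF : BddMeas F) (ν : Measure β)
    [IsProbabilityMeasure ν] : BddMeas (fun a => ∫ b, F (a, b) ∂ν) := by
  obtain ⟨C, hC⟩ := hF.bdd
  exact ⟨hF.meas.stronglyMeasurable.integral_prod_right'.measurable, C,
    fun a => abs_integral_le fun b => hC _⟩

theorem integral_exp_pos (hg : BddMeas g) (μ : Measure α) [IsProbabilityMeasure μ] :
    0 < ∫ x, Real.exp (g x) ∂μ :=
  MeasureTheory.integral_exp_pos (hg.exp.integrable μ)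

theorem log_integral_exp {F : α × β → ℝ} (hF : BddMeas F) (ν : Measure β)
    [IsProbabilityMeasure ν] :
    BddMeas (fun a => Real.log (∫ b, Real.exp (F (a, b)) ∂ν)) := by
  obtain ⟨C, hC⟩ := hF.bdd
  refine ⟨(hF.exp.integral_right ν).meas.log, C, fun a => ?_⟩
  have hFa : BddMeas (fun b => F (a, b)) := hF.comp measurable_prodMk_left
  have hpos := hFa.integral_exp_pos ν
  have hle : ∫ b, Real.exp (F (a, b)) ∂ν ≤ Real.exp C := by
    calc ∫ b, Real.exp (F (a, b)) ∂ν ≤ ∫ _, Real.exp C ∂ν :=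
          integral_mono (hFa.exp.integrable ν) (integrable_const _)
            fun b => Real.exp_le_exp.2 ((le_abs_self _).trans (hC _))
      _ = Real.exp C := by simp
  have hge : Real.exp (-C) ≤ ∫ b, Real.exp (F (a, b)) ∂ν := by
    calc Real.exp (-C) = ∫ _, Real.exp (-C) ∂ν := by simp
      _ ≤ _ := integral_mono (integrable_const _) (hFa.exp.integrable ν)
            fun b => Real.exp_le_exp.2 (neg_le_of_abs_le (hC _))
  exact abs_le.2 ⟨(Real.le_log_iff_exp_le hpos).2 hge, (Real.log_le_iff_le_exp hpos).2 hle⟩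

end BddMeas

/-! ### Entropy and its subadditivity -/

/-- The entropy `E[F log F] - E[F] log E[F]` of `F = exp g`. Parametrizing by `g` keeps `F`
positive, so that no convention for `0 log 0` is needed. -/
noncomputable def ent {α : Type*} [MeasurableSpace α] (μ : Measure α) (g : α → ℝ) : ℝ :=
  ∫ x, Real.exp (g x) * g x ∂μ - (∫ x, Real.exp (g x) ∂μ) * Real.log (∫ x, Real.exp (g x) ∂μ)

section Entropy

variable {α β : Type*} [MeasurableSpace α] [MeasurableSpace β]

/-- The Gibbs variational inequality (duality between entropy and the log-Laplace transform). -/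
theorem integral_exp_mul_le (μ : Measure α) [IsProbabilityMeasure μ] {g h : α → ℝ}
    (hg : BddMeas g) (hh : BddMeas h) :
    ∫ x, Real.exp (g x) * h x ∂μ ≤
      ent μ g + (∫ x, Real.exp (g x) ∂μ) * Real.log (∫ x, Real.exp (h x) ∂μ) := by
  have hm := hg.integral_exp_pos μ
  have hk := hh.integral_exp_pos μ
  set m := ∫ x, Real.exp (g x) ∂μ with hm_def
  set k := ∫ x, Real.exp (h x) ∂μ with hk_def
  -- Young's inequality for the normalized densities `exp g / m` and `exp h / k`
  have hpt : ∀ x, Real.exp (g x) * h x ≤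
      Real.exp (g x) * g x + (Real.log k - Real.log m - 1) * Real.exp (g x)
        + m / k * Real.exp (h x) := by
    intro x
    have h1 := Real.add_one_le_exp (h x - g x - (Real.log k - Real.log m))
    have h2 : Real.exp (h x - g x - (Real.log k - Real.log m)) * Real.exp (g x)
        = m / k * Real.exp (h x) := by
      rw [← Real.exp_add, ← Real.exp_log hm, ← Real.exp_log hk, ← Real.exp_sub, ← Real.exp_add,
        Real.log_exp, Real.log_exp]
      ring_nf
    nlinarith [mul_le_mul_of_nonneg_right h1 (Real.exp_pos (g x)).le]
  have hint := integral_mono ((hg.exp.mul hh).integrable μ)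
    ((((hg.exp.mul hg).add (hg.exp.const_mul (Real.log k - Real.log m - 1))).add
      (hh.exp.const_mul (m / k))).integrable μ) hpt
  rw [integral_add (((hg.exp.mul hg).add (hg.exp.const_mul _)).integrable μ)
      ((hh.exp.const_mul _).integrable μ),
    integral_add ((hg.exp.mul hg).integrable μ) ((hg.exp.const_mul _).integrable μ),
    integral_const_mul, integral_const_mul, ← hm_def, ← hk_def, div_mul_cancel₀ _ hk.ne'] at hint
  unfold ent
  rw [← hm_def]
  linarith

/-- A one-dimensional entropy bound, with a free centring constant `c`. -/
theorem ent_le_integral (μ : Measure α) [IsProbabilityMeasure μ] {g : α → ℝ} (hg : BddMeas g)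
    (c : ℝ) :
    ent μ g ≤ ∫ x, Real.exp (g x) * (Real.exp (c - g x) - (c - g x) - 1) ∂μ := by
  have hm := hg.integral_exp_pos μ
  have hpt : ∀ x, Real.exp (g x) * (Real.exp (c - g x) - (c - g x) - 1) =
      Real.exp (g x) * g x - (c + 1) * Real.exp (g x) + Real.exp c := by
    intro x
    have : Real.exp (g x) * Real.exp (c - g x) = Real.exp c := by
      rw [← Real.exp_add]; ring_nf
    linear_combination this
  simp_rw [hpt]
  rw [integral_add (((hg.exp.mul hg).sub (hg.exp.const_mul _)).integrable μ) (integrable_const _),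
    integral_sub ((hg.exp.mul hg).integrable μ) ((hg.exp.const_mul _).integrable μ),
    integral_const_mul]
  unfold ent
  set m := ∫ x, Real.exp (g x) ∂μ
  simp only [integral_const, probReal_univ, smul_eq_mul, one_mul]
  have h1 := Real.add_one_le_exp (c - Real.log m)
  rw [Real.exp_sub, Real.exp_log hm, le_div_iff₀ hm] at h1
  linarith

theorem BddMeas.ent_right {F : α × β → ℝ} (hF : BddMeas F) (ν : Measure β)
    [IsProbabilityMeasure ν] : BddMeas (fun a => ent ν (fun b => F (a, b))) :=
  ((hF.exp.mul hF).integral_right ν).sub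
    ((hF.exp.integral_right ν).mul (hF.log_integral_exp ν))

/-- Subadditivity of entropy on a product of two probability spaces. -/
theorem ent_prod_le (μ : Measure α) [IsProbabilityMeasure μ] (ν : Measure β)
    [IsProbabilityMeasure ν] {g : α × β → ℝ} (hg : BddMeas g) :
    ent (μ.prod ν) g ≤
      ∫ a, ent ν (fun b => g (a, b)) ∂μ + ∫ b, ent μ (fun a => g (a, b)) ∂ν := by
  set h : α → ℝ := fun a => Real.log (∫ b, Real.exp (g (a, b)) ∂ν) with hh_def
  have hh : BddMeas h := hg.log_integral_exp ν
  have hga : ∀ a, BddMeas (fun b => g (a, b)) := fun a => hg.comp measurable_prodMk_left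
  have hgb : ∀ b, BddMeas (fun a => g (a, b)) := fun b => hg.comp measurable_prodMk_right
  have hexp : ∀ a, Real.exp (h a) = ∫ b, Real.exp (g (a, b)) ∂ν := fun a =>
    Real.exp_log ((hga a).integral_exp_pos ν)
  have hm : ∫ z, Real.exp (g z) ∂(μ.prod ν) = ∫ a, Real.exp (h a) ∂μ := by
    rw [integral_prod _ (hg.exp.integrable _)]
    simp_rw [hexp]
  have hg' : BddMeas (fun z : β × α => g (z.2, z.1)) := hg.comp measurable_swap
  -- the chain rule for entropy
  have hchain : ent (μ.prod ν) g = ∫ a, ent ν (fun b => g (a, b)) ∂μ + ent μ h := by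
    have h1 : ∫ z, Real.exp (g z) * g z ∂(μ.prod ν) =
        ∫ a, ent ν (fun b => g (a, b)) ∂μ + ∫ a, Real.exp (h a) * h a ∂μ := by
      rw [integral_prod _ ((hg.exp.mul hg).integrable _),
        ← integral_add ((hg.ent_right ν).integrable μ) ((hh.exp.mul hh).integrable μ)]
      refine integral_congr_ae (Filter.Eventually.of_forall fun a => ?_)
      simp only [ent, hexp]
      simp only [hh_def]
      ring
    unfold ent at h1 ⊢
    rw [h1, hm]
    ring
  -- averaging over `b` does not increase the entropy in the variable `a`
  have havg : ent μ h ≤ ∫ b, ent μ (fun a => g (a, b)) ∂ν := by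
    have hfub : ∫ b, ∫ a, Real.exp (g (a, b)) * h a ∂μ ∂ν = ∫ a, Real.exp (h a) * h a ∂μ := by
      have hi : BddMeas (fun z : α × β => Real.exp (g z) * h z.1) :=
        hg.exp.mul (hh.comp measurable_fst)
      rw [← integral_integral_swap (hi.integrable (μ.prod ν))]
      refine integral_congr_ae (Filter.Eventually.of_forall fun a => ?_)
      simp only [integral_mul_const, hexp]
    have hfub2 : ∫ b, ∫ a, Real.exp (g (a, b)) ∂μ ∂ν = ∫ a, Real.exp (h a) ∂μ := by
      rw [← integral_integral_swap (hg.exp.integrable (μ.prod ν))]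
      simp_rw [hexp]
    have hgibbs := fun b => integral_exp_mul_le μ (hgb b) hh
    have hB1 : BddMeas (fun b => ∫ a, Real.exp (g (a, b)) * h a ∂μ) :=
      (hg'.exp.mul (hh.comp measurable_snd)).integral_right μ
    have hB2 : BddMeas (fun b => ∫ a, Real.exp (g (a, b)) ∂μ) := hg'.exp.integral_right μ
    have hB3 : BddMeas (fun b => ent μ (fun a => g (a, b))) := hg'.ent_right μ
    have hint := integral_mono (hB1.integrable ν)
      ((hB3.add (hB2.mul (BddMeas.const _))).integrable ν) hgibbs
    rw [integral_add (hB3.integrable ν) ((hB2.mul (BddMeas.const _)).integrable ν), hfub,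
      integral_mul_const, hfub2] at hint
    unfold ent at hint ⊢
    linarith
  linarith

theorem ent_map {T : α → β} {μ : Measure α} {ν : Measure β} (hT : MeasurePreserving T μ ν)
    {g : β → ℝ} (hg : BddMeas g) : ent ν g = ent μ (fun x => g (T x)) := by
  unfold ent
  rw [← hT.map_eq, integral_map hT.measurable.aemeasurable
      (hg.exp.mul hg).meas.aestronglyMeasurable,
    integral_map hT.measurable.aemeasurable hg.exp.meas.aestronglyMeasurable]

theorem BddMeas.update {n : ℕ} {g : (Fin n → α) → ℝ} (hg : BddMeas g) (k : Fin n) :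
    BddMeas (fun z : (Fin n → α) × α => g (Function.update z.1 k z.2)) :=
  hg.comp measurable_update'

/-- Subadditivity of entropy for product measures: the entropy is at most the sum of the expected
entropies with respect to the single coordinates. -/
theorem ent_pi_le_sum (μ : Measure α) [IsProbabilityMeasure μ] :
    ∀ {n : ℕ} {g : (Fin n → α) → ℝ}, BddMeas g →
      ent (Measure.pi fun _ => μ) g ≤
        ∑ k, ∫ x, ent μ (fun y => g (Function.update x k y)) ∂(Measure.pi fun _ => μ) := by
  intro n
  induction n with
  | zero =>
    intro g hg
    have hg0 : ∀ x, g x = g default := fun x => congrArg g (Subsingleton.elim _ _)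
    simp [ent, hg0]
  | succ n ih =>
    intro g hg
    set π := Measure.pi fun _ : Fin n => μ
    have hT : MeasurePreserving (fun z : α × (Fin n → α) => (Fin.cons z.1 z.2 : Fin (n + 1) → α))
        (μ.prod π) (Measure.pi fun _ : Fin (n + 1) => μ) := by
      have := (measurePreserving_piFinSuccAbove (fun _ : Fin (n + 1) => μ) 0).symm
      simpa [MeasurableEquiv.piFinSuccAbove, Fin.insertNthEquiv] using this
    have hgT : BddMeas (fun z : α × (Fin n → α) => g (Fin.cons z.1 z.2)) := hg.comp hT.measurable
    have hint : ∀ {F : (Fin (n + 1) → α) → ℝ}, BddMeas F →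
        ∫ x, F x ∂(Measure.pi fun _ : Fin (n + 1) => μ) =
          ∫ z, F (Fin.cons z.1 z.2) ∂(μ.prod π) := fun hF => by
      rw [← hT.map_eq, integral_map hT.measurable.aemeasurable hF.meas.aestronglyMeasurable]
    have hentk : ∀ k, BddMeas (fun x : Fin (n + 1) → α =>
        ent μ (fun y => g (Function.update x k y))) := fun k => (hg.update k).ent_right μ
    rw [ent_map hT hg, Fin.sum_univ_succ]
    refine (ent_prod_le μ π hgT).trans ?_
    rw [add_comm]
    refine add_le_add (le_of_eq ?_) ?_
    · rw [hint (hentk 0), integral_prod_symm _ (((hentk 0).comp hT.measurable).integrable _)]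
      simp [Fin.update_cons_zero]
    · have hks : ∀ k : Fin n, BddMeas (fun z : α × (Fin n → α) =>
          ent μ (fun y => g (Fin.cons z.1 (Function.update z.2 k y)))) := fun k => by
        have := (hentk k.succ).comp hT.measurable
        simpa only [Fin.cons_update] using this
      calc ∫ a, ent π (fun x => g (Fin.cons a x)) ∂μ
          ≤ ∫ a, ∑ k, ∫ x, ent μ (fun y => g (Fin.cons a (Function.update x k y))) ∂π ∂μ :=
            integral_mono ((hgT.ent_right π).integrable μ)
              ((BddMeas.sum fun k => (hks k).integral_right π).integrable μ)
              fun a => ih (hgT.comp measurable_prodMk_left)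
        _ = ∑ k, ∫ a, ∫ x, ent μ (fun y => g (Fin.cons a (Function.update x k y))) ∂π ∂μ :=
            integral_finsetSum _ fun k _ => ((hks k).integral_right π).integrable μ
        _ = _ := by
            refine Finset.sum_congr rfl fun k _ => ?_
            rw [hint (hentk k.succ),
              integral_prod _ (((hentk k.succ).comp hT.measurable).integrable _)]
            simp only [Fin.cons_update]

end Entropy

/-! ### Resampling a coordinate -/

section Resampling

variable {α : Type*} [MeasurableSpace α]

/-- Replacing one coordinate of an i.i.d. sample by an independent copy preserves its law. -/
theorem measurePreserving_update {n : ℕ} (μ : Measure α) [IsProbabilityMeasure μ] (k : Fin n) :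
    MeasurePreserving (fun z : (Fin n → α) × α => Function.update z.1 k z.2)
      ((Measure.pi fun _ : Fin n => μ).prod μ) (Measure.pi fun _ : Fin n => μ) := by
  have hmeas : Measurable (fun z : (Fin n → α) × α => Function.update z.1 k z.2) :=
    measurable_update'
  refine ⟨hmeas, (Measure.pi_eq fun s hs => ?_).symm⟩
  rw [Measure.map_apply hmeas (MeasurableSet.univ_pi hs)]
  have hpre : (fun z : (Fin n → α) × α => Function.update z.1 k z.2) ⁻¹' (Set.univ.pi s) =
      (Set.univ.pi (Function.update s k Set.univ)) ×ˢ s k := by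
    ext ⟨x, y⟩
    simp only [Set.mem_preimage, Set.mem_pi, Set.mem_univ, true_implies, Set.mem_prod]
    constructor
    · intro h
      refine ⟨fun i => ?_, by simpa using h k⟩
      by_cases hi : i = k
      · subst hi; simp
      · simpa [hi] using h i
    · rintro ⟨h, hy⟩ i
      by_cases hi : i = k
      · subst hi; simpa using hy
      · simpa [hi] using h i
  rw [hpre, Measure.prod_prod, Measure.pi_pi, ← Finset.mul_prod_erase _ _ (Finset.mem_univ k),
    ← Finset.mul_prod_erase _ (fun i => μ (s i)) (Finset.mem_univ k)]
  have : ∏ i ∈ Finset.univ.erase k, μ (Function.update s k Set.univ i) =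
      ∏ i ∈ Finset.univ.erase k, μ (s i) :=
    Finset.prod_congr rfl fun i hi => by
      rw [Function.update_of_ne (Finset.ne_of_mem_erase hi)]
  rw [this]
  simp [mul_comm]

theorem integral_integral_update {n : ℕ} (μ : Measure α) [IsProbabilityMeasure μ] (k : Fin n)
    {F : (Fin n → α) → ℝ} (hF : BddMeas F) :
    ∫ x, ∫ y, F (Function.update x k y) ∂μ ∂(Measure.pi fun _ => μ) =
      ∫ x, F x ∂(Measure.pi fun _ => μ) := by
  have hT := measurePreserving_update μ k
  rw [← integral_prod _ ((hF.update k).integrable _)]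
  conv_rhs => rw [← hT.map_eq]
  rw [integral_map hT.measurable.aemeasurable hF.meas.aestronglyMeasurable]

/-- Subadditivity of entropy combined with the one-dimensional entropy bound `ent_le_integral`.
The centring constant may depend on the coordinate `k` and on the other coordinates of `x`. -/
theorem ent_pi_le_of_forall {n : ℕ} (μ : Measure α) [IsProbabilityMeasure μ]
    {g : (Fin n → α) → ℝ} (hg : BddMeas g) {B : Fin n → (Fin n → α) → ℝ}
    (hB : ∀ k, BddMeas (B k))
    (h : ∀ k x, ∃ c, ∀ y, Real.exp (c - g (Function.update x k y))
      - (c - g (Function.update x k y)) - 1 ≤ B k (Function.update x k y)) :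
    ent (Measure.pi fun _ => μ) g ≤
      ∫ x, Real.exp (g x) * ∑ k, B k x ∂(Measure.pi fun _ => μ) := by
  refine (ent_pi_le_sum μ hg).trans ?_
  have hEB : ∀ k, BddMeas (fun x => Real.exp (g x) * B k x) := fun k => hg.exp.mul (hB k)
  simp_rw [Finset.mul_sum]
  rw [integral_finsetSum _ fun k _ => (hEB k).integrable _]
  refine Finset.sum_le_sum fun k _ => ?_
  rw [← integral_integral_update μ k (hEB k)]
  refine integral_mono (((hg.update k).ent_right μ).integrable _)
    ((((hEB k).update k).integral_right μ).integrable _) fun x => ?_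
  obtain ⟨c, hc⟩ := h k x
  have hgx : BddMeas (fun y => g (Function.update x k y)) :=
    (hg.update k).comp measurable_prodMk_left
  refine (ent_le_integral μ hgx c).trans (integral_mono ?_ ?_ fun y => ?_)
  · exact (hgx.exp.mul ((((BddMeas.const c).sub hgx).exp.sub ((BddMeas.const c).sub hgx)).sub
      (BddMeas.const 1))).integrable μ
  · exact (((hEB k).update k).comp measurable_prodMk_left).integrable μ
  · exact mul_le_mul_of_nonneg_left (hc y) (Real.exp_pos _).le

end Resampling

/-! ### Herbst's argument -/

section Herbst

variable {α : Type*} [MeasurableSpace α]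

theorem BddMeas.integrableExpSet_eq {Z : α → ℝ} (hZ : BddMeas Z) (μ : Measure α)
    [IsProbabilityMeasure μ] : integrableExpSet Z μ = Set.univ :=
  Set.eq_univ_of_forall fun t => (hZ.const_mul t).exp.integrable μ

theorem BddMeas.hasDerivAt_cgf {Z : α → ℝ} (hZ : BddMeas Z) (μ : Measure α)
    [IsProbabilityMeasure μ] (t : ℝ) :
    HasDerivAt (cgf Z μ) ((∫ x, Z x * Real.exp (t * Z x) ∂μ) / mgf Z μ t) t := by
  have ht : t ∈ interior (integrableExpSet Z μ) := by simp [hZ.integrableExpSet_eq μ]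
  rw [← deriv_cgf ht]
  exact (analyticAt_cgf ht).differentiableAt.hasDerivAt

theorem ent_const_mul (μ : Measure α) (Z : α → ℝ) (t : ℝ) :
    ent μ (fun x => t * Z x) =
      t * ∫ x, Z x * Real.exp (t * Z x) ∂μ - mgf Z μ t * cgf Z μ t := by
  unfold ent cgf mgf
  rw [← integral_const_mul]
  congr 2
  ext x
  ring

/-- Herbst's argument: a function of `t` that decreases on `(0, b)` and behaves like
`cgf Z μ t / t` at `0` is bounded by the expectation of `Z`. The functions `w` and `H` are an
integrating factor and the integrated right hand side of a differential inequality. -/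
theorem mul_cgf_sub_le_integral {Z : α → ℝ} (hZ : BddMeas Z) (μ : Measure α)
    [IsProbabilityMeasure μ] {w w' H H' : ℝ → ℝ} {b : ℝ}
    (hw : ∀ t, 0 < t → t < b → HasDerivAt w (w' t) t)
    (hH : ∀ t, 0 < t → t < b → HasDerivAt H (H' t) t)
    (hw0 : Tendsto (fun t => t * w t) (𝓝[>] 0) (𝓝 1)) (hH0 : Tendsto H (𝓝[>] 0) (𝓝 0))
    (hle : ∀ t, 0 < t → t < b →
      w' t * cgf Z μ t + w t * ((∫ x, Z x * Real.exp (t * Z x) ∂μ) / mgf Z μ t) ≤ H' t)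
    {t : ℝ} (ht : 0 < t) (htb : t < b) : w t * cgf Z μ t - H t ≤ ∫ x, Z x ∂μ := by
  have hder : ∀ s ∈ Set.Ioo 0 b, HasDerivAt (fun s => w s * cgf Z μ s - H s)
      (w' s * cgf Z μ s + w s * ((∫ x, Z x * Real.exp (s * Z x) ∂μ) / mgf Z μ s) - H' s) s :=
    fun s hs => ((hw s hs.1 hs.2).mul (hZ.hasDerivAt_cgf μ s)).sub (hH s hs.1 hs.2)
  have hanti : AntitoneOn (fun s => w s * cgf Z μ s - H s) (Set.Ioo 0 b) := by
    refine antitoneOn_of_deriv_nonpos (convex_Ioo 0 b)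
      (fun s hs => (hder s hs).continuousAt.continuousWithinAt)
      (fun s hs => ?_) fun s hs => ?_
    · rw [interior_Ioo] at hs
      exact (hder s hs).differentiableAt.differentiableWithinAt
    · rw [interior_Ioo] at hs
      rw [(hder s hs).deriv]
      linarith [hle s hs.1 hs.2]
  have hlim : Tendsto (fun s => w s * cgf Z μ s - H s) (𝓝[>] 0) (𝓝 (∫ x, Z x ∂μ)) := by
    have h0 := (hZ.hasDerivAt_cgf μ 0).tendsto_slope_zero_right
    simp only [zero_mul, Real.exp_zero, mul_one, mgf_zero, div_one, zero_add, cgf_zero, sub_zero,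
      smul_eq_mul] at h0
    have h1 := (hw0.mul h0).sub hH0
    rw [one_mul, sub_zero] at h1
    refine h1.congr' ?_
    filter_upwards [self_mem_nhdsWithin] with s hs
    have hs' : s ≠ 0 := (Set.mem_Ioi.1 hs).ne'
    field_simp
  refine ge_of_tendsto hlim ?_
  filter_upwards [Ioo_mem_nhdsGT ht] with s hs
  exact hanti ⟨hs.1, hs.2.trans htb⟩ ⟨ht, htb⟩ hs.2.le

end Herbst

/-! ### Self-bounding functions -/

/-- `Z` is self-bounding with constant `c`: changing the coordinate `k` decreases `Z` by at most
`r k`, and the sum of the squares of the `r k` is at most `c * Z`. -/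
structure SelfBounding {α : Type*} [MeasurableSpace α] {n : ℕ} (c : ℝ) (Z : (Fin n → α) → ℝ)
    (r : Fin n → (Fin n → α) → ℝ) : Prop where
  bddMeas : BddMeas Z
  bddMeas_bound (k : Fin n) : BddMeas (r k)
  nonneg (k : Fin n) (x : Fin n → α) : 0 ≤ r k x
  sub_le (k : Fin n) (x : Fin n → α) (y : α) : Z x - Z (Function.update x k y) ≤ r k x
  sum_sq_le (x : Fin n → α) : ∑ k, r k x ^ 2 ≤ c * Z x

theorem exp_neg_add_sub_one_le {x : ℝ} (hx : 0 ≤ x) : Real.exp (-x) + x - 1 ≤ x ^ 2 / 2 := by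
  have h1 := Real.quadratic_le_exp_of_nonneg hx
  have h2 : Real.exp (-x) * Real.exp x = 1 := by rw [← Real.exp_add]; simp
  have h3 := Real.exp_pos (-x)
  nlinarith [mul_le_mul_of_nonneg_left h1 h3.le, sq_nonneg (x ^ 2), sq_nonneg (1 - x)]

theorem exp_mul_sub_le {t r : ℝ} (ht : 0 ≤ t) (hr : 0 ≤ r) (hr1 : r ≤ 1) :
    Real.exp (t * r) - t * r - 1 ≤ r ^ 2 * (Real.exp t - t - 1) := by
  have hder : ∀ s : ℝ, HasDerivAt
      (fun s => r ^ 2 * (Real.exp s - s - 1) - (Real.exp (s * r) - s * r - 1))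
      (r ^ 2 * (Real.exp s - 1) - (Real.exp (s * r) * r - r)) s := fun s => by
    have h1 : HasDerivAt (fun s : ℝ => s * r) r s := by simpa using (hasDerivAt_id s).mul_const r
    exact (((Real.hasDerivAt_exp s).sub (hasDerivAt_id s)).sub_const 1).const_mul (r ^ 2)
      |>.sub ((h1.exp.sub h1).sub_const 1)
  have hmono : MonotoneOn
      (fun s => r ^ 2 * (Real.exp s - s - 1) - (Real.exp (s * r) - s * r - 1)) (Set.Ici 0) := by
    refine monotoneOn_of_deriv_nonneg (convex_Ici 0)
      (fun s _ => (hder s).continuousAt.continuousWithinAt)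
      (fun s _ => (hder s).differentiableAt.differentiableWithinAt) fun s _ => ?_
    rw [(hder s).deriv]
    -- convexity of the exponential function between `0` and `s`
    have hconv := convexOn_exp.2 (Set.mem_univ s) (Set.mem_univ 0) hr (sub_nonneg.2 hr1)
      (by ring)
    simp only [smul_eq_mul, mul_zero, add_zero, Real.exp_zero, mul_one] at hconv
    rw [mul_comm r s] at hconv
    nlinarith [mul_le_mul_of_nonneg_left hconv hr]
  have := hmono (Set.mem_Ici.2 le_rfl) (Set.mem_Ici.2 ht) ht
  simp only [Real.exp_zero, zero_mul, sub_zero, sub_self, mul_zero] at this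
  linarith

namespace SelfBounding

variable {α : Type*} [MeasurableSpace α] {n : ℕ} {c : ℝ} {Z : (Fin n → α) → ℝ}
  {r : Fin n → (Fin n → α) → ℝ}

/-- The infimum over the coordinate `k`, as a constant depending on the other coordinates. It is
not required to depend on them measurably. -/
theorem exists_inf [Nonempty α] (h : SelfBounding c Z r) (k : Fin n) (x : Fin n → α) :
    ∃ m, ∀ y, 0 ≤ Z (Function.update x k y) - m ∧
      Z (Function.update x k y) - m ≤ r k (Function.update x k y) := by
  obtain ⟨C, hC⟩ := h.bddMeas.bdd
  have hbdd : BddBelow (Set.range fun y => Z (Function.update x k y)) :=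
    ⟨-C, by rintro _ ⟨y, rfl⟩; exact neg_le_of_abs_le (hC _)⟩
  refine ⟨⨅ y, Z (Function.update x k y), fun y => ⟨sub_nonneg.2 (ciInf_le hbdd y), ?_⟩⟩
  rw [sub_le_comm]
  refine le_ciInf fun y' => ?_
  have := h.sub_le k (Function.update x k y) y'
  rw [Function.update_idem] at this
  linarith

/-- Upper bound for the log-Laplace transform of a self-bounding function. -/
theorem cgf_le (h : SelfBounding c Z r) (μ : Measure α) [IsProbabilityMeasure μ] {t : ℝ}
    (ht : 0 < t) :
    (1 - c * t / 2) * cgf Z (Measure.pi fun _ => μ) t ≤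
      t * ∫ x, Z x ∂(Measure.pi fun _ => μ) := by
  have : Nonempty α := nonempty_of_isProbabilityMeasure μ
  set π := Measure.pi fun _ : Fin n => μ
  have hZ := h.bddMeas
  have hent : ∀ s, 0 < s → ent π (fun x => s * Z x) ≤
      s ^ 2 / 2 * (c * ∫ x, Z x * Real.exp (s * Z x) ∂π) := by
    intro s hs
    have hsZ := hZ.const_mul s
    have h1 := ent_pi_le_of_forall μ hsZ (B := fun k x => s ^ 2 / 2 * r k x ^ 2)
      (fun k => (h.bddMeas_bound k).sq.const_mul _) (fun k x => by
        obtain ⟨m, hm⟩ := h.exists_inf k x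
        refine ⟨s * m, fun y => ?_⟩
        obtain ⟨h0, hr⟩ := hm y
        have h2 := exp_neg_add_sub_one_le (mul_nonneg hs.le h0)
        have h3 : (s * (Z (Function.update x k y) - m)) ^ 2 ≤
            s ^ 2 * r k (Function.update x k y) ^ 2 := by
          rw [mul_pow]
          exact mul_le_mul_of_nonneg_left (pow_le_pow_left₀ h0 hr 2) (sq_nonneg s)
        rw [show s * m - s * Z (Function.update x k y) = -(s * (Z (Function.update x k y) - m))
          by ring]
        linarith)
    refine h1.trans ?_
    rw [← mul_assoc, ← integral_const_mul]
    refine integral_mono ((hsZ.exp.mul (BddMeas.sum fun k =>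
        (h.bddMeas_bound k).sq.const_mul _)).integrable π)
      (((hZ.mul hsZ.exp).const_mul _).integrable π) fun x => ?_
    simp only [← Finset.mul_sum]
    have h4 := mul_le_mul_of_nonneg_left (h.sum_sq_le x)
      (mul_nonneg (Real.exp_pos (s * Z x)).le (by positivity : 0 ≤ s ^ 2 / 2))
    linarith
  have key := mul_cgf_sub_le_integral hZ π (w := fun s => s⁻¹ - c / 2)
    (w' := fun s => -(s ^ 2)⁻¹) (H := fun _ => 0) (H' := fun _ => 0) (b := t + 1)
    (fun s hs _ => (hasDerivAt_inv hs.ne').sub_const _) (fun s _ _ => hasDerivAt_const _ _)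
    (by
      have : Tendsto (fun s : ℝ => 1 - s * (c / 2)) (𝓝[>] 0) (𝓝 1) := by
        have : Continuous (fun s : ℝ => 1 - s * (c / 2)) := by fun_prop
        simpa using (this.tendsto 0).mono_left nhdsWithin_le_nhds
      refine this.congr' ?_
      filter_upwards [self_mem_nhdsWithin] with s hs
      have hs' : s ≠ 0 := (Set.mem_Ioi.1 hs).ne'
      field_simp)
    tendsto_const_nhds
    (fun s hs _ => by
      have hm : 0 < mgf Z π s := (hZ.const_mul s).integral_exp_pos π
      have h5 := hent s hs
      rw [ent_const_mul] at h5
      set I := ∫ x, Z x * Real.exp (s * Z x) ∂π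
      set G := cgf Z π s
      have h6 : -(s ^ 2)⁻¹ * G + (s⁻¹ - c / 2) * (I / mgf Z π s) =
          (s * I - mgf Z π s * G - s ^ 2 / 2 * (c * I)) / (s ^ 2 * mgf Z π s) := by
        field_simp
        ring
      rw [h6]
      exact div_nonpos_of_nonpos_of_nonneg (by linarith) (by positivity))
    ht (lt_add_one t)
  have h7 := mul_le_mul_of_nonneg_left key ht.le
  have h8 : t * ((t⁻¹ - c / 2) * cgf Z π t - 0) = (1 - c * t / 2) * cgf Z π t := by
    field_simp
    ring
  linarith

/-- The Laplace transform of a self-bounding function with normalized constants is, at negative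
arguments, at most that of a Poisson variable with the same expectation. -/
theorem cgf_neg_le (h : SelfBounding 1 Z r) (hr1 : ∀ k x, r k x ≤ 1) (μ : Measure α)
    [IsProbabilityMeasure μ] {t : ℝ} (ht : 0 < t) :
    cgf (fun x => -Z x) (Measure.pi fun _ => μ) t ≤
      -((1 - Real.exp (-t)) * ∫ x, Z x ∂(Measure.pi fun _ => μ)) := by
  have : Nonempty α := nonempty_of_isProbabilityMeasure μ
  set π := Measure.pi fun _ : Fin n => μ
  have hZ := h.bddMeas.neg
  have hent : ∀ s, 0 < s → ent π (fun x => s * -Z x) ≤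
      -((Real.exp s - s - 1) * ∫ x, -Z x * Real.exp (s * -Z x) ∂π) := by
    intro s hs
    have hsZ := hZ.const_mul s
    have hφ : 0 ≤ Real.exp s - s - 1 := by linarith [Real.add_one_le_exp s]
    have h1 := ent_pi_le_of_forall μ hsZ (B := fun k x => (Real.exp s - s - 1) * r k x ^ 2)
      (fun k => (h.bddMeas_bound k).sq.const_mul _) (fun k x => by
        obtain ⟨m, hm⟩ := h.exists_inf k x
        refine ⟨s * -m, fun y => ?_⟩
        obtain ⟨h0, hr⟩ := hm y
        have h2 := exp_mul_sub_le hs.le h0 (hr.trans (hr1 _ _))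
        have h3 := mul_le_mul_of_nonneg_right (pow_le_pow_left₀ h0 hr 2) hφ
        rw [show s * -m - s * -Z (Function.update x k y) = s * (Z (Function.update x k y) - m)
          by ring]
        linarith)
    refine h1.trans ?_
    rw [← neg_mul, ← integral_const_mul]
    refine integral_mono ((hsZ.exp.mul (BddMeas.sum fun k =>
        (h.bddMeas_bound k).sq.const_mul _)).integrable π)
      (((hZ.mul hsZ.exp).const_mul _).integrable π) fun x => ?_
    simp only [← Finset.mul_sum]
    have h4 := mul_le_mul_of_nonneg_left (h.sum_sq_le x)
      (mul_nonneg (Real.exp_pos (s * -Z x)).le hφ)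
    linarith
  have hpos : ∀ s : ℝ, 0 < s → 0 < 1 - Real.exp (-s) := fun s hs => by
    have : Real.exp (-s) < 1 := by simpa using hs
    linarith
  have hE : ∀ s : ℝ, HasDerivAt (fun s => 1 - Real.exp (-s)) (Real.exp (-s)) s := fun s => by
    simpa using ((hasDerivAt_neg s).exp).const_sub 1
  have key := mul_cgf_sub_le_integral hZ π (w := fun s => (1 - Real.exp (-s))⁻¹)
    (w' := fun s => -Real.exp (-s) / (1 - Real.exp (-s)) ^ 2) (H := fun _ => 0)
    (H' := fun _ => 0) (b := t + 1)
    (fun s hs _ => (hE s).inv (hpos s hs).ne') (fun s _ _ => hasDerivAt_const _ _)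
    (by
      have h0 := ((hE 0).tendsto_slope_zero_right).inv₀ (by simp)
      simp only [zero_add, neg_zero, Real.exp_zero, sub_self, sub_zero, smul_eq_mul, inv_one]
        at h0
      refine h0.congr fun s => ?_
      rw [mul_inv, inv_inv])
    tendsto_const_nhds
    (fun s hs _ => by
      have hm : 0 < mgf (fun x => -Z x) π s := (hZ.const_mul s).integral_exp_pos π
      have h5 := hent s hs
      rw [ent_const_mul] at h5
      set I := ∫ x, -Z x * Real.exp (s * -Z x) ∂π
      set G := cgf (fun x => -Z x) π s
      set m := mgf (fun x => -Z x) π s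
      have hp := hpos s hs
      have hee : Real.exp (-s) * Real.exp s = 1 := by rw [← Real.exp_add]; simp
      have h6 : -Real.exp (-s) / (1 - Real.exp (-s)) ^ 2 * G + (1 - Real.exp (-s))⁻¹ * (I / m) =
          Real.exp (-s) * ((Real.exp s - 1) * I - m * G) / ((1 - Real.exp (-s)) ^ 2 * m) := by
        have : Real.exp (-s) * ((Real.exp s - 1) * I - m * G) =
            (1 - Real.exp (-s)) * I - Real.exp (-s) * (m * G) := by linear_combination I * hee
        rw [this]
        field_simp
        ring
      rw [h6]
      refine div_nonpos_of_nonpos_of_nonneg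
        (mul_nonpos_of_nonneg_of_nonpos (Real.exp_pos _).le ?_) (by positivity)
      linarith)
    ht (lt_add_one t)
  have h7 := mul_le_mul_of_nonneg_left key (hpos t ht).le
  rw [sub_zero, mul_inv_cancel_left₀ (hpos t ht).ne', integral_neg] at h7
  linarith

/-- The lower tail of a normalized self-bounding function. The choice `exp (-t) = √(z / m)`, with
`m` the expectation and `z` the threshold, in Chernoff's bound yields a clean bound for square
roots. -/
theorem measure_sqrt_add_lt_le (h : SelfBounding 1 Z r) (hr1 : ∀ k x, r k x ≤ 1) (μ : Measure α)
    [IsProbabilityMeasure μ] {L : ℝ} (hL : 0 ≤ L) :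
    (Measure.pi fun _ => μ).real
      {x | √(Z x) + √L < √(∫ x, Z x ∂(Measure.pi fun _ => μ))} ≤ Real.exp (-L) := by
  set π := Measure.pi fun _ : Fin n => μ
  set m := ∫ x, Z x ∂π with hm
  rcases le_or_gt (√m) (√L) with hmL | hmL
  · have : {x | √(Z x) + √L < √m} = ∅ := by
      ext x
      simp only [Set.mem_ofPred_eq, Set.mem_empty_iff_false, iff_false, not_lt]
      linarith [Real.sqrt_nonneg (Z x)]
    rw [this]
    simpa using (Real.exp_pos _).le
  rcases hL.eq_or_lt with rfl | hL
  · simp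
  have hLs : 0 < √L := Real.sqrt_pos.2 hL
  have hms : 0 < √m := hLs.trans hmL
  have hm0 : 0 < m := Real.sqrt_pos.1 hms
  set q := (√m - √L) / √m with hq
  have hq0 : 0 < q := div_pos (by linarith) hms
  have hq1 : q < 1 := (div_lt_one hms).2 (by linarith)
  set z := (√m - √L) ^ 2 with hz
  have hzq : z = m * q ^ 2 := by
    rw [hq, div_pow, Real.sq_sqrt hm0.le, mul_div_cancel₀ _ hm0.ne']
  set t := -Real.log q with ht_def
  have ht : 0 < t := by
    have := Real.log_neg hq0 hq1
    linarith
  have hexpt : Real.exp (-t) = q := by rw [ht_def, neg_neg, Real.exp_log hq0]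
  have hsub : {x | √(Z x) + √L < √m} ⊆ {x | -z ≤ -Z x} := by
    intro x hx
    have hZ0 : 0 ≤ Z x := by
      have := h.sum_sq_le x
      rw [one_mul] at this
      exact (Finset.sum_nonneg fun k _ => sq_nonneg _).trans this
    have hx' : √(Z x) < √m - √L := by
      have : √(Z x) + √L < √m := hx
      linarith
    have := pow_le_pow_left₀ (Real.sqrt_nonneg _) hx'.le 2
    rw [Real.sq_sqrt hZ0] at this
    simpa using this
  have hint : Integrable (fun x => Real.exp (t * -Z x)) π :=
    (h.bddMeas.neg.const_mul t).exp.integrable π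
  have hch := measure_ge_le_exp_cgf (μ := π) (X := fun x => -Z x) (-z) ht.le hint
  have hcgf := h.cgf_neg_le hr1 μ ht
  refine (measureReal_mono hsub).trans (hch.trans (Real.exp_le_exp.2 ?_))
  have hlog : t ≤ q⁻¹ - 1 := by
    have := Real.log_le_sub_one_of_pos (inv_pos.2 hq0)
    rwa [Real.log_inv] at this
  have hqt : q * t ≤ 1 - q := by
    have := mul_le_mul_of_nonneg_left hlog hq0.le
    rwa [mul_sub, mul_inv_cancel₀ hq0.ne', mul_one] at this
  have hLq : L = m * (1 - q) ^ 2 := by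
    have h1 : √m * (1 - q) = √L := by
      rw [hq]; field_simp; ring
    rw [← Real.sq_sqrt hL.le, ← h1, mul_pow, Real.sq_sqrt hm0.le]
  rw [hexpt, ← hm] at hcgf
  have h2 : m * q * (q * t) ≤ m * q * (1 - q) :=
    mul_le_mul_of_nonneg_left hqt (mul_pos hm0 hq0).le
  have : - t * -z = m * q * (q * t) := by rw [hzq]; ring
  rw [this]
  nlinarith

end SelfBounding

/-! ### Conditional variances -/

/-- The conditional variance of `f` with respect to the coordinate `k`, given the others. -/
noncomputable def condVar {α : Type*} [MeasurableSpace α] (μ : Measure α) {n : ℕ}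
    (f : (Fin n → α) → ℝ) (k : Fin n) (x : Fin n → α) : ℝ :=
  ∫ y, (f (Function.update x k y) - ∫ y', f (Function.update x k y') ∂μ) ^ 2 ∂μ

/-- The sum of the conditional variances, whose expectation is the variance proxy in Bernstein's
inequality and, by the Efron–Stein inequality, an upper bound for the variance of `f`. -/
noncomputable def sumCondVar {α : Type*} [MeasurableSpace α] (μ : Measure α) {n : ℕ}
    (f : (Fin n → α) → ℝ) (x : Fin n → α) : ℝ :=
  ∑ k, condVar μ f k x

section CondVar

variable {α : Type*} [MeasurableSpace α] {n : ℕ} {f : (Fin n → α) → ℝ}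

theorem bddMeas_condVar (hf : BddMeas f) (μ : Measure α) [IsProbabilityMeasure μ] (k : Fin n) :
    BddMeas (condVar μ f k) :=
  BddMeas.integral_right (F := fun z : (Fin n → α) × α =>
      (f (Function.update z.1 k z.2) - ∫ y', f (Function.update z.1 k y') ∂μ) ^ 2)
    (((hf.update k).sub (((hf.update k).integral_right μ).comp measurable_fst)).sq) μ

theorem bddMeas_sumCondVar (hf : BddMeas f) (μ : Measure α) [IsProbabilityMeasure μ] :
    BddMeas (sumCondVar μ f) :=
  BddMeas.sum fun k => bddMeas_condVar hf μ k

theorem condVar_nonneg (μ : Measure α) (k : Fin n) (x : Fin n → α) : 0 ≤ condVar μ f k x :=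
  integral_nonneg fun _ => sq_nonneg _

theorem condVar_update_self (μ : Measure α) (k : Fin n) (x : Fin n → α) (y : α) :
    condVar μ f k (Function.update x k y) = condVar μ f k x := by
  simp [condVar]

theorem integral_abs_le_sqrt {g : α → ℝ} (hg : BddMeas g) (μ : Measure α)
    [IsProbabilityMeasure μ] : ∫ y, |g y| ∂μ ≤ √(∫ y, g y ^ 2 ∂μ) := by
  refine Real.le_sqrt_of_sq_le ?_
  set a := ∫ y, |g y| ∂μ with ha
  have h1 : 0 ≤ ∫ y, (g y ^ 2 - 2 * a * |g y| + a ^ 2) ∂μ := integral_nonneg fun y => by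
    have : g y ^ 2 - 2 * a * |g y| + a ^ 2 = (|g y| - a) ^ 2 := by rw [← sq_abs (g y)]; ring
    rw [Pi.zero_apply, this]
    exact sq_nonneg _
  rw [integral_add ((hg.sq.sub (hg.abs.const_mul _)).integrable μ) (integrable_const _),
    integral_sub (hg.sq.integrable μ) ((hg.abs.const_mul _).integrable μ), integral_const_mul,
    ← ha] at h1
  simp only [integral_const, probReal_univ, smul_eq_mul, one_mul] at h1
  linarith

/-- Two functions whose difference oscillates by at most `j` have close variances. -/
theorem variance_sub_le {X Y : α → ℝ} (hX : BddMeas X) (hY : BddMeas Y) (μ : Measure α)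
    [IsProbabilityMeasure μ] {j : ℝ} (hj : ∀ y y', |(X y - Y y) - (X y' - Y y')| ≤ j) :
    ∫ y, (X y - ∫ y', X y' ∂μ) ^ 2 ∂μ - ∫ y, (Y y - ∫ y', Y y' ∂μ) ^ 2 ∂μ ≤
      2 * j * √(∫ y, (X y - ∫ y', X y' ∂μ) ^ 2 ∂μ) := by
  have : Nonempty α := nonempty_of_isProbabilityMeasure μ
  set a := ∫ y', X y' ∂μ with ha
  set b := ∫ y', Y y' ∂μ with hb
  have hX' : BddMeas (fun y => X y - a) := hX.sub (BddMeas.const a)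
  have hY' : BddMeas (fun y => Y y - b) := hY.sub (BddMeas.const b)
  have hj0 : 0 ≤ j := by
    obtain ⟨y⟩ := ‹Nonempty α›
    exact (abs_nonneg _).trans (hj y y)
  have hdev : ∀ y, |(X y - a) - (Y y - b)| ≤ j := fun y => by
    have h1 := BddMeas.abs_integral_le (μ := μ) (g := fun y' => (X y - Y y) - (X y' - Y y')) (hj y)
    rw [integral_sub (integrable_const _) ((hX.sub hY).integrable μ),
      integral_sub (hX.integrable μ) (hY.integrable μ), ← ha, ← hb] at h1
    simp only [integral_const, probReal_univ, smul_eq_mul, one_mul] at h1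
    rwa [show (X y - a) - (Y y - b) = X y - Y y - (a - b) by ring]
  have hpt : ∀ y, (X y - a) ^ 2 - (Y y - b) ^ 2 ≤ 2 * j * |X y - a| := fun y => by
    have h1 : (X y - a) * ((X y - a) - (Y y - b)) ≤ |X y - a| * j :=
      (le_abs_self _).trans (by
        rw [abs_mul]; exact mul_le_mul_of_nonneg_left (hdev y) (abs_nonneg _))
    nlinarith [sq_nonneg ((X y - a) - (Y y - b))]
  rw [← integral_sub (hX'.sq.integrable μ) (hY'.sq.integrable μ)]
  calc _ ≤ ∫ y, 2 * j * |X y - a| ∂μ :=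
        integral_mono ((hX'.sq.sub hY'.sq).integrable μ) ((hX'.abs.const_mul _).integrable μ) hpt
    _ = 2 * j * ∫ y, |X y - a| ∂μ := integral_const_mul _ _
    _ ≤ _ := mul_le_mul_of_nonneg_left (integral_abs_le_sqrt hX' μ) (by positivity)

/-- If the mixed second differences of `f` are small, then the sum of its conditional variances is
self-bounding. -/
theorem selfBounding_sumCondVar (hf : BddMeas f) (μ : Measure α) [IsProbabilityMeasure μ]
    {j : ℝ} (hj0 : 0 ≤ j) (hj : ∀ k l : Fin n, l ≠ k → ∀ x z z' y y',
      |partialDiff l z z' (partialDiff k y y' f) x| ≤ j) :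
    SelfBounding (4 * (n * j) ^ 2) (sumCondVar μ f)
      (fun _ x => 2 * j * ∑ k, √(condVar μ f k x)) where
  bddMeas := bddMeas_sumCondVar hf μ
  bddMeas_bound _ := (BddMeas.sum fun k => (bddMeas_condVar hf μ k).sqrt).const_mul _
  nonneg _ x := mul_nonneg (by positivity) (Finset.sum_nonneg fun k _ => Real.sqrt_nonneg _)
  sub_le l x y := by
    rw [sumCondVar, sumCondVar, ← Finset.sum_sub_distrib, Finset.mul_sum]
    refine Finset.sum_le_sum fun k _ => ?_
    by_cases hkl : l = k
    · subst hkl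
      rw [condVar_update_self, sub_self]
      positivity
    · refine variance_sub_le (X := fun y' => f (Function.update x k y'))
        (Y := fun y' => f (Function.update (Function.update x l y) k y'))
        ((hf.update k).comp measurable_prodMk_left)
        ((hf.update k).comp measurable_prodMk_left) μ fun y₁ y₂ => ?_
      have := hj k l hkl x (x l) y y₁ y₂
      simp only [partialDiff, Function.update_eq_self] at this
      convert this using 2
      ring
  sum_sq_le x := by
    have h1 : (∑ k, √(condVar μ f k x)) ^ 2 ≤ n * sumCondVar μ f x := by
      refine (sq_sum_le_card_mul_sum_sq).trans (le_of_eq ?_)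
      rw [Finset.card_univ, Fintype.card_fin, sumCondVar]
      congr 1
      exact Finset.sum_congr rfl fun k _ => Real.sq_sqrt (condVar_nonneg μ k x)
    rw [Finset.sum_const, Finset.card_univ, Fintype.card_fin, nsmul_eq_mul]
    have h2 := mul_le_mul_of_nonneg_left h1 (by positivity : 0 ≤ n * (4 * j ^ 2))
    linarith

end CondVar

/-! ### Bernstein's inequality for functions with small interactions -/

theorem mul_exp_sub_exp_add_one_le {u b : ℝ} (hu : u ≤ b) (hb : 0 ≤ b) (hb3 : b < 3) :
    u * Real.exp u - Real.exp u + 1 ≤ u ^ 2 / 2 / (1 - b / 3) ^ 2 := by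
  have hder : ∀ s : ℝ, HasDerivAt (fun s => s * Real.exp s - Real.exp s + 1)
      (s * Real.exp s) s := fun s => by
    have := (((hasDerivAt_id s).mul (Real.hasDerivAt_exp s)).sub
      (Real.hasDerivAt_exp s)).add_const 1
    refine this.congr_deriv ?_
    simp
  have hb' : 0 < 1 - b / 3 := by linarith
  rcases le_total u 0 with hu0 | hu0
  · have hanti : AntitoneOn (fun s : ℝ => s ^ 2 / 2 - (s * Real.exp s - Real.exp s + 1))
        (Set.Iic 0) := by
      have hd : ∀ s : ℝ, HasDerivAt
          (fun s : ℝ => s ^ 2 / 2 - (s * Real.exp s - Real.exp s + 1))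
          (s - s * Real.exp s) s := fun s => by
        refine (((hasDerivAt_pow 2 s).div_const 2).sub (hder s)).congr_deriv ?_
        simp
      refine antitoneOn_of_deriv_nonpos (convex_Iic 0)
        (fun s _ => (hd s).continuousAt.continuousWithinAt)
        (fun s _ => (hd s).differentiableAt.differentiableWithinAt) fun s hs => ?_
      rw [interior_Iic] at hs
      rw [(hd s).deriv]
      have : Real.exp s ≤ 1 := Real.exp_le_one_iff.2 (Set.mem_Iio.1 hs).le
      nlinarith [Set.mem_Iio.1 hs]
    have h1 := hanti (Set.mem_Iic.2 hu0) (Set.mem_Iic.2 le_rfl) hu0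
    simp only [Real.exp_zero] at h1
    have h2 : u ^ 2 / 2 ≤ u ^ 2 / 2 / (1 - b / 3) ^ 2 :=
      le_div_self (by positivity) (by positivity) (pow_le_one₀ hb'.le (by linarith))
    linarith
  · have hmono : MonotoneOn (fun s : ℝ => s ^ 2 / 2 / (1 - s / 3) ^ 2
        - (s * Real.exp s - Real.exp s + 1)) (Set.Ico 0 3) := by
      have hd : ∀ s ∈ Set.Ico (0 : ℝ) 3, HasDerivAt (fun s : ℝ => s ^ 2 / 2 / (1 - s / 3) ^ 2
          - (s * Real.exp s - Real.exp s + 1)) (s / (1 - s / 3) ^ 3 - s * Real.exp s) s := by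
        intro s hs
        have hs3 : 1 - s / 3 ≠ 0 := by
          have := hs.2
          intro h
          linarith
        have h1 : HasDerivAt (fun s : ℝ => 1 - s / 3) (-(1 / 3)) s :=
          ((hasDerivAt_id s).div_const 3).const_sub 1
        refine ((((hasDerivAt_pow 2 s).div_const 2).div (h1.pow 2) (pow_ne_zero 2 hs3)).sub
          (hder s)).congr_deriv ?_
        congr 1
        have h3 : (3 : ℝ) - s ≠ 0 := by
          intro h
          exact hs3 (by linarith)
        simp only [Pi.pow_apply]
        field_simp
        ring
      refine monotoneOn_of_deriv_nonneg (convex_Ico 0 3)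
        (fun s hs => (hd s hs).continuousAt.continuousWithinAt)
        (fun s hs => (hd s (interior_subset hs)).differentiableAt.differentiableWithinAt)
        fun s hs => ?_
      have hs' := interior_subset hs
      rw [(hd s hs').deriv]
      have hpos : 0 < 1 - s / 3 := by linarith [hs'.2]
      -- `exp (-s / 3) ≥ 1 - s / 3`, cubed
      have h1 : (1 - s / 3) ^ 3 ≤ Real.exp (-s) := by
        have := pow_le_pow_left₀ hpos.le (Real.one_sub_le_exp_neg (s / 3)) 3
        rwa [← Real.exp_nat_mul, show ((3 : ℕ) : ℝ) * -(s / 3) = -s by push_cast; ring] at this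
      have h2 : Real.exp s ≤ ((1 - s / 3) ^ 3)⁻¹ := by
        rw [← inv_inv (Real.exp s), ← Real.exp_neg]
        exact inv_anti₀ (pow_pos hpos 3) h1
      rw [div_eq_mul_inv, ← mul_sub]
      exact mul_nonneg hs'.1 (sub_nonneg.2 h2)
    have h1 := hmono ⟨le_rfl, by norm_num⟩ ⟨hu0, hu.trans_lt hb3⟩ hu0
    simp only [Real.exp_zero] at h1
    have h2 : u ^ 2 / 2 / (1 - u / 3) ^ 2 ≤ u ^ 2 / 2 / (1 - b / 3) ^ 2 := by
      gcongr
    norm_num at h1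
    linarith

section Bernstein

variable {α : Type*} [MeasurableSpace α]

/-- The entropy bound behind Bernstein's inequality. -/
theorem ent_le_of_sub_integral_le (μ : Measure α) [IsProbabilityMeasure μ] {X : α → ℝ}
    (hX : BddMeas X) {b : ℝ} (hb : 0 ≤ b) (hb3 : b < 3) (hXb : ∀ y, X y - ∫ y', X y' ∂μ ≤ b) :
    ent μ X ≤ (∫ y, Real.exp (X y) ∂μ) *
      ((∫ y, (X y - ∫ y', X y' ∂μ) ^ 2 ∂μ) / 2 / (1 - b / 3) ^ 2) := by
  set c := ∫ y', X y' ∂μ with hc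
  have hX' : BddMeas (fun y => X y - c) := hX.sub (BddMeas.const c)
  have hcX : BddMeas (fun y => c - X y) := (BddMeas.const c).sub hX
  have hjensen : Real.exp c ≤ ∫ y, Real.exp (X y) ∂μ := by
    have h1 : ∀ y, Real.exp c * (X y - c) + Real.exp c ≤ Real.exp (X y) := fun y => by
      have h2 := Real.add_one_le_exp (X y - c)
      have h3 : Real.exp c * Real.exp (X y - c) = Real.exp (X y) := by
        rw [← Real.exp_add]; ring_nf
      nlinarith [mul_le_mul_of_nonneg_left h2 (Real.exp_pos c).le]
    have h2 := integral_mono (((hX'.const_mul _).add (BddMeas.const _)).integrable μ)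
      (hX.exp.integrable μ) h1
    rw [integral_add ((hX'.const_mul _).integrable μ) (integrable_const _), integral_const_mul,
      integral_sub (hX.integrable μ) (integrable_const _), ← hc] at h2
    simpa using h2
  calc ent μ X ≤ ∫ y, Real.exp (X y) * (Real.exp (c - X y) - (c - X y) - 1) ∂μ :=
        ent_le_integral μ hX c
    _ ≤ ∫ y, Real.exp c / 2 / (1 - b / 3) ^ 2 * (X y - c) ^ 2 ∂μ := by
        refine integral_mono ((hX.exp.mul ((hcX.exp.sub hcX).sub (BddMeas.const 1))).integrable μ)
          ((hX'.sq.const_mul _).integrable μ) fun y => ?_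
        have h1 := mul_le_mul_of_nonneg_left (mul_exp_sub_exp_add_one_le (hXb y) hb hb3)
          (Real.exp_pos c).le
        have h2 : Real.exp c * Real.exp (X y - c) = Real.exp (X y) := by
          rw [← Real.exp_add]; ring_nf
        have h3 : Real.exp (X y) * Real.exp (c - X y) = Real.exp c := by
          rw [← Real.exp_add]; ring_nf
        calc Real.exp (X y) * (Real.exp (c - X y) - (c - X y) - 1)
            = Real.exp c * ((X y - c) * Real.exp (X y - c) - Real.exp (X y - c) + 1) := by
              linear_combination h3 - (X y - c - 1) * h2
          _ ≤ _ := h1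
          _ = _ := by ring
    _ = Real.exp c * ((∫ y, (X y - c) ^ 2 ∂μ) / 2 / (1 - b / 3) ^ 2) := by
        rw [integral_const_mul]; ring
    _ ≤ _ := mul_le_mul_of_nonneg_right hjensen
        (div_nonneg (div_nonneg (integral_nonneg fun _ => sq_nonneg _) (by norm_num))
          (sq_nonneg _))

variable {n : ℕ} {f : (Fin n → α) → ℝ}

theorem ent_pi_le_sumCondVar (μ : Measure α) [IsProbabilityMeasure μ] (hf : BddMeas f) {M : ℝ}
    (hM0 : 0 ≤ M) (hM : ∀ k x y y', partialDiff k y y' f x ≤ M) {t : ℝ} (ht : 0 ≤ t)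
    (htM : t * M < 3) :
    ent (Measure.pi fun _ => μ) (fun x => t * f x) ≤ (t / (1 - t * M / 3)) ^ 2 / 2 *
      ∫ x, Real.exp (t * f x) * sumCondVar μ f x ∂(Measure.pi fun _ => μ) := by
  set π := Measure.pi fun _ : Fin n => μ
  have htf := hf.const_mul t
  have hE : ∀ k, BddMeas (fun x => Real.exp (t * f x) * condVar μ f k x) := fun k =>
    htf.exp.mul (bddMeas_condVar hf μ k)
  refine (ent_pi_le_sum μ htf).trans ?_
  simp only [sumCondVar, Finset.mul_sum]
  rw [integral_finsetSum _ fun k _ => (hE k).integrable _, Finset.mul_sum]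
  refine Finset.sum_le_sum fun k _ => ?_
  rw [← integral_integral_update μ k (hE k), ← integral_const_mul]
  refine integral_mono (((htf.update k).ent_right μ).integrable _)
    (((((hE k).update k).integral_right μ).const_mul _).integrable _) fun x => ?_
  have hfx : BddMeas (fun y => f (Function.update x k y)) :=
    (hf.update k).comp measurable_prodMk_left
  have hdev : ∀ y, t * f (Function.update x k y) - ∫ y', t * f (Function.update x k y') ∂μ
      ≤ t * M := fun y => by
    rw [integral_const_mul, ← mul_sub]
    refine mul_le_mul_of_nonneg_left ?_ ht
    have h1 : ∫ _, (f (Function.update x k y) - M) ∂μ ≤ ∫ y', f (Function.update x k y') ∂μ :=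
      integral_mono (integrable_const _) (hfx.integrable μ) fun y' => by
        have := hM k x y y'
        simp only [partialDiff] at this
        linarith
    simp only [integral_const, probReal_univ, smul_eq_mul, one_mul] at h1
    linarith
  refine (ent_le_of_sub_integral_le μ (hfx.const_mul t) (mul_nonneg ht hM0) htM hdev).trans
    (le_of_eq ?_)
  have hvar : ∫ y, (t * f (Function.update x k y) -
      ∫ y', t * f (Function.update x k y') ∂μ) ^ 2 ∂μ = t ^ 2 * condVar μ f k x := by
    rw [condVar, ← integral_const_mul, integral_const_mul]
    simp only [← mul_sub, mul_pow]
  rw [hvar]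
  simp only [condVar_update_self, integral_mul_const]
  generalize 1 - t * M / 3 = q
  ring

/-- A sub-gamma bound for the log-Laplace transform of a function with small interactions. -/
theorem cgf_le_of_interaction (μ : Measure α) [IsProbabilityMeasure μ] (hf : BddMeas f)
    {M j J : ℝ} (hM0 : 0 ≤ M) (hM : ∀ k x y y', partialDiff k y y' f x ≤ M) (hj0 : 0 ≤ j)
    (hj : ∀ k l : Fin n, l ≠ k → ∀ x z z' y y',
      |partialDiff l z z' (partialDiff k y y' f) x| ≤ j)
    (hJ : 0 < J) (hjJ : n * j ≤ J) {t : ℝ} (ht : 0 < t) (htγ : t * (M / 3 + J) < 1) :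
    cgf f (Measure.pi fun _ => μ) t ≤ t * ∫ x, f x ∂(Measure.pi fun _ => μ) +
      (∫ x, sumCondVar μ f x ∂(Measure.pi fun _ => μ)) / 2 * t ^ 2 / (1 - t * (M / 3 + J)) := by
  set π := Measure.pi fun _ : Fin n => μ
  set γ := M / 3 + J with hγ_def
  have hγ : 0 < γ := by positivity
  set V := ∫ x, sumCondVar μ f x ∂π with hV
  have hS := bddMeas_sumCondVar hf μ
  have hV0 : 0 ≤ V := integral_nonneg fun x => Finset.sum_nonneg fun k _ => condVar_nonneg μ k x
  have hsb := selfBounding_sumCondVar hf μ hj0 hj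
  -- the differential inequality
  have hdiff : ∀ s, 0 < s → s * γ < 1 →
      (1 - s * γ) ^ 2 * ent π (fun x => s * f x) ≤ mgf f π s * (V / 2 * s ^ 2) := by
    intro s hs hsγ
    have hsM : s * M < 3 := by
      have : 0 < s * J := mul_pos hs hJ
      have : s * γ = s * M / 3 + s * J := by rw [hγ_def]; ring
      linarith
    have hq : 0 < 1 - s * M / 3 := by linarith
    set τ := s / (1 - s * M / 3) with hτ
    have hτ0 : 0 < τ := div_pos hs hq
    have hτs : (1 - s * M / 3) * τ = s := mul_div_cancel₀ s hq.ne'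
    have hτJ : (1 - s * M / 3) * (1 - τ * J) = 1 - s * γ := by
      rw [hγ_def]; linear_combination (-J) * hτs
    have hτJ0 : 0 < 1 - τ * J := by
      by_contra h
      have := mul_nonpos_of_nonneg_of_nonpos hq.le (not_lt.1 h)
      linarith
    have hm : 0 < mgf f π s := (hf.const_mul s).integral_exp_pos π
    have h1 := ent_pi_le_sumCondVar μ hf hM0 hM hs.le hsM
    set S := ∫ x, Real.exp (s * f x) * sumCondVar μ f x ∂π
    -- this value of `θ` balances the two losses, in the variational and the self-bounding estimate
    set θ := τ / (2 * J) with hθ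
    have hθ0 : 0 < θ := by positivity
    have hθJ : θ * J = τ / 2 := by rw [hθ]; field_simp
    have h2 := integral_exp_mul_le π (hf.const_mul s) (hS.const_mul θ)
    have h3 : ∫ x, Real.exp (s * f x) * (θ * sumCondVar μ f x) ∂π = θ * S := by
      rw [← integral_const_mul]
      congr 1
      ext x
      ring
    rw [h3] at h2
    change θ * S ≤ ent π (fun x => s * f x) + mgf f π s * cgf (sumCondVar μ f) π θ at h2
    have h4 := hsb.cgf_le μ hθ0
    set E := ent π (fun x => s * f x)
    set C := cgf (sumCondVar μ f) π θ
    have hC : (1 - τ * J) * C ≤ θ * V := by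
      have hC0 : 0 ≤ C := by
        have h5 : 0 ≤ θ * V := by positivity
        refine Real.log_nonneg ?_
        calc (1 : ℝ) = ∫ _, (1 : ℝ) ∂π := by simp
          _ ≤ _ := integral_mono (integrable_const _) ((hS.const_mul θ).exp.integrable π)
            fun x => Real.one_le_exp (mul_nonneg hθ0.le
              (Finset.sum_nonneg fun k _ => condVar_nonneg μ k x))
      refine (mul_le_mul_of_nonneg_right ?_ hC0).trans h4
      have h6 : (n * j) ^ 2 ≤ J ^ 2 := pow_le_pow_left₀ (by positivity) hjJ 2
      have h7 : τ * J = 2 * J ^ 2 * θ := by linear_combination (-2 * J) * hθJ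
      rw [h7]
      nlinarith
    have h8 : E ≤ (τ * J) * (E + mgf f π s * C) := by
      calc E ≤ τ ^ 2 / 2 * S := h1
        _ = τ * J * (θ * S) := by linear_combination (-τ * S) * hθJ
        _ ≤ _ := mul_le_mul_of_nonneg_left h2 (by positivity)
    have h9 : (1 - τ * J) ^ 2 * E ≤ mgf f π s * (V / 2 * τ ^ 2) := by
      have h10 : (1 - τ * J) * E ≤ τ * J * mgf f π s * C := by linarith
      have h11 := mul_le_mul_of_nonneg_left h10 hτJ0.le
      have h12 := mul_le_mul_of_nonneg_left hC (by positivity : 0 ≤ τ * J * mgf f π s)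
      have h13 : τ * J * mgf f π s * (θ * V) = mgf f π s * (V / 2 * τ ^ 2) := by
        linear_combination (τ * mgf f π s * V) * hθJ
      linarith
    have h14 := mul_le_mul_of_nonneg_left h9 (sq_nonneg (1 - s * M / 3))
    calc (1 - s * γ) ^ 2 * E = (1 - s * M / 3) ^ 2 * ((1 - τ * J) ^ 2 * E) := by
          rw [← hτJ]; ring
      _ ≤ _ := h14
      _ = mgf f π s * (V / 2 * ((1 - s * M / 3) * τ) ^ 2) := by ring
      _ = _ := by rw [hτs]
  have hlt : ∀ s, s < γ⁻¹ → s * γ < 1 := fun s hs => by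
    simpa [hγ.ne'] using mul_lt_mul_of_pos_right hs hγ
  have key := mul_cgf_sub_le_integral hf π (w := fun s => s⁻¹) (w' := fun s => -(s ^ 2)⁻¹)
    (H := fun s => V / 2 * s / (1 - s * γ)) (H' := fun s => V / 2 / (1 - s * γ) ^ 2) (b := γ⁻¹)
    (fun s hs _ => hasDerivAt_inv hs.ne')
    (fun s hs hsb => by
      have h0 : 1 - s * γ ≠ 0 := (sub_pos.2 (hlt s hsb)).ne'
      have h1 : HasDerivAt (fun s => 1 - s * γ) (-γ) s := by
        simpa using ((hasDerivAt_id s).mul_const γ).const_sub 1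
      have h2 : HasDerivAt (fun s => V / 2 * s) (V / 2) s := by
        simpa using (hasDerivAt_id s).const_mul (V / 2)
      refine (h2.div h1 h0).congr_deriv ?_
      field_simp
      ring)
    (by
      refine tendsto_const_nhds.congr' ?_
      filter_upwards [self_mem_nhdsWithin] with s hs
      exact (mul_inv_cancel₀ (Set.mem_Ioi.1 hs).ne').symm)
    (by
      have : ContinuousAt (fun s => V / 2 * s / (1 - s * γ)) 0 := by
        refine ContinuousAt.div (by fun_prop) (by fun_prop) (by simp)
      have h := this.tendsto
      simp only [mul_zero, zero_div] at h
      exact h.mono_left nhdsWithin_le_nhds)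
    (fun s hs hsb => by
      have hm : 0 < mgf f π s := (hf.const_mul s).integral_exp_pos π
      have h0 : 0 < 1 - s * γ := sub_pos.2 (hlt s hsb)
      have h5 := hdiff s hs (hlt s hsb)
      rw [ent_const_mul] at h5
      set I := ∫ x, f x * Real.exp (s * f x) ∂π
      set G := cgf f π s
      have h6 : -(s ^ 2)⁻¹ * G + s⁻¹ * (I / mgf f π s) =
          (s * I - mgf f π s * G) / (s ^ 2 * mgf f π s) := by
        field_simp
        ring
      rw [h6, div_le_div_iff₀ (by positivity) (by positivity)]
      linarith)
    ht (lt_of_mul_lt_mul_right (by rwa [inv_mul_cancel₀ hγ.ne']) hγ.le)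
  have h7 := mul_le_mul_of_nonneg_left key ht.le
  rw [mul_sub, mul_inv_cancel_left₀ ht.ne'] at h7
  have h8 : t * (V / 2 * t / (1 - t * γ)) = V / 2 * t ^ 2 / (1 - t * γ) := by ring
  linarith

/-- Bernstein's inequality for functions with small interactions. -/
theorem measure_bernstein_le (μ : Measure α) [IsProbabilityMeasure μ] (hf : BddMeas f)
    {M j J γ : ℝ} (hM0 : 0 ≤ M) (hM : ∀ k x y y', partialDiff k y y' f x ≤ M) (hj0 : 0 ≤ j)
    (hj : ∀ k l : Fin n, l ≠ k → ∀ x z z' y y',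
      |partialDiff l z z' (partialDiff k y y' f) x| ≤ j)
    (hJ : 0 < J) (hjJ : n * j ≤ J) (hγ : M / 3 + J < γ) {L : ℝ} (hL : 0 < L) :
    (Measure.pi fun _ => μ).real {x | ∫ x, f x ∂(Measure.pi fun _ => μ) +
        √(2 * (∫ x, sumCondVar μ f x ∂(Measure.pi fun _ => μ)) * L) + γ * L < f x} ≤
      Real.exp (-L) := by
  set π := Measure.pi fun _ : Fin n => μ
  set V := ∫ x, sumCondVar μ f x ∂π with hV
  set m := ∫ x, f x ∂π
  have hV0 : 0 ≤ V := integral_nonneg fun x => Finset.sum_nonneg fun k _ => condVar_nonneg μ k x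
  set s := √(2 * V * L) with hs
  have hchernoff : ∀ t, 0 < t → t * (M / 3 + J) < 1 →
      V / 2 * t ^ 2 / (1 - t * (M / 3 + J)) + L ≤ t * (s + γ * L) →
      π.real {x | m + s + γ * L < f x} ≤ Real.exp (-L) := by
    intro t ht htγ hle
    have hint : Integrable (fun x => Real.exp (t * f x)) π := (hf.const_mul t).exp.integrable π
    have hch := measure_ge_le_exp_cgf (μ := π) (X := f) (m + s + γ * L) ht.le hint
    have hcgf := cgf_le_of_interaction μ hf hM0 hM hj0 hj hJ hjJ ht htγ
    refine (measureReal_mono fun x hx => ?_).trans (hch.trans (Real.exp_le_exp.2 ?_))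
    · exact (show m + s + γ * L < f x from hx).le
    · linarith
  have hγ0 : 0 < M / 3 + J := by positivity
  have hγ1 : 0 < γ := hγ0.trans hγ
  rcases hV0.eq_or_lt with hV0 | hV0
  · refine hchernoff γ⁻¹ (inv_pos.2 hγ1) ?_ ?_
    · rw [inv_mul_lt_one₀ hγ1]
      exact hγ
    · rw [hs, ← hV0]
      simp [hγ1.ne']
  · have hs0 : 0 < s := Real.sqrt_pos.2 (by positivity)
    have hs2 : s ^ 2 = 2 * V * L := Real.sq_sqrt (by positivity)
    set g := M / 3 + J
    -- the minimizer of the exponent is `u / (1 + g * u)` with `u = √(2 * L / V)`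
    set u := s / V with hu
    have hu0 : 0 < u := div_pos hs0 hV0
    have huV : V * u = s := by rw [hu]; field_simp
    have hus : u * s = 2 * L := by
      have : V * (u * s) = V * (2 * L) := by linear_combination s * huV + hs2
      exact mul_left_cancel₀ hV0.ne' this
    have hgu : 0 < 1 + g * u := by positivity
    refine hchernoff (u / (1 + g * u)) (by positivity) ?_ ?_
    · rw [div_mul_eq_mul_div, div_lt_one hgu]
      linarith
    · have h1 : 1 - u / (1 + g * u) * g = 1 / (1 + g * u) := by
        field_simp
        ring
      have h2 : V / 2 * (u / (1 + g * u)) ^ 2 / (1 / (1 + g * u)) + L =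
          u / (1 + g * u) * (s + g * L) := by
        have h3 : V / 2 * u ^ 2 = L := by linear_combination (u * huV + hus) / 2
        calc V / 2 * (u / (1 + g * u)) ^ 2 / (1 / (1 + g * u)) + L
            = V / 2 * u ^ 2 / (1 + g * u) + L := by field_simp
          _ = (2 * L + g * u * L) / (1 + g * u) := by rw [h3]; field_simp; ring
          _ = _ := by rw [← hus]; ring
      rw [h1, h2]
      gcongr

end Bernstein

/-! ### The variance estimator -/

/-- The difference which enters the variance estimator through the deleted index `j` and the index
`i = j.succAbove p`. Using `p : Fin n` in place of `i ≠ j` makes it a plain first difference of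
`f` at the sample `j.removeNth x`. -/
def estDiff {α : Type*} {n : ℕ} (f : (Fin n → α) → ℝ) (j : Fin (n + 1)) (p : Fin n)
    (x : Fin (n + 1) → α) : ℝ :=
  f (j.removeNth x) - f (Function.update (j.removeNth x) p (x j))

theorem varEstimator_eq {α : Type*} {n : ℕ} (f : (Fin n → α) → ℝ) (x : Fin (n + 1) → α) :
    varEstimator f x = 1 / (2 * ((n : ℝ) + 1)) * ∑ j, ∑ p, estDiff f j p x ^ 2 := by
  rw [varEstimator]
  congr 1
  refine Finset.sum_congr rfl fun j _ => ?_
  rw [Finset.sum_filter, Fin.sum_univ_succAbove _ j]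
  simp [Fin.succAbove_ne, Fin.removeNth_update_succAbove, estDiff]

theorem varEstimator_nonneg {α : Type*} {n : ℕ} (f : (Fin n → α) → ℝ) (x : Fin (n + 1) → α) :
    0 ≤ varEstimator f x := by
  rw [varEstimator_eq]
  positivity

section Estimator

variable {α : Type*} {n : ℕ} {f : (Fin n → α) → ℝ} {M e : ℝ}

theorem abs_partialDiff_le (hM : ∀ k x y y', partialDiff k y y' f x ≤ M) (k : Fin n)
    (x : Fin n → α) (y y' : α) : |partialDiff k y y' f x| ≤ M := by
  refine abs_le.2 ⟨?_, hM k x y y'⟩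
  have := hM k x y' y
  simp only [partialDiff] at this ⊢
  linarith

theorem abs_estDiff_le (hM : ∀ k x y y', partialDiff k y y' f x ≤ M) (j : Fin (n + 1)) (p : Fin n)
    (x : Fin (n + 1) → α) : |estDiff f j p x| ≤ M := by
  have := abs_partialDiff_le hM p (j.removeNth x) (j.removeNth x p) (x j)
  simpa only [partialDiff, Function.update_eq_self, estDiff] using this

/-- A change of a coordinate not involved in the difference `estDiff f j p` is a mixed second
difference of `f`. -/
theorem abs_estDiff_sub_update_le (he : ∀ k l : Fin n, l ≠ k → ∀ x z z' y y',
      |partialDiff l z z' (partialDiff k y y' f) x| ≤ e)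
    {j k : Fin (n + 1)} {p : Fin n} (hkj : k ≠ j) (hkp : k ≠ j.succAbove p)
    (x : Fin (n + 1) → α) (y : α) :
    |estDiff f j p x - estDiff f j p (Function.update x k y)| ≤ e := by
  obtain ⟨q, rfl⟩ := Fin.exists_succAbove_eq hkj
  have hqp : q ≠ p := fun h => hkp (by rw [h])
  have := he p q hqp (j.removeNth x) (j.removeNth x q) y (j.removeNth x p) (x j)
  rw [estDiff, estDiff, Fin.removeNth_update_succAbove, Function.update_of_ne hkj.symm]
  simp only [partialDiff, Function.update_eq_self] at this
  have h1 : Function.update (Function.update (j.removeNth x) q y) p (j.removeNth x p) =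
      Function.update (j.removeNth x) q y :=
    Function.update_eq_self_iff.2 (by rw [Function.update_of_ne hqp.symm])
  rwa [h1] at this

/-- The part of the bound for the decrease of the estimator after a change of coordinate `k` which
comes from the differences involving that coordinate. -/
noncomputable def estInvolved (f : (Fin n → α) → ℝ) (k : Fin (n + 1)) (x : Fin (n + 1) → α) : ℝ :=
  ∑ j, ∑ p, ((if k = j then estDiff f j p x ^ 2 else 0)
    + if k = j.succAbove p then estDiff f j p x ^ 2 else 0)

/-- The bound for the decrease of the estimator after a change of coordinate `k`. -/
noncomputable def estBound (f : (Fin n → α) → ℝ) (e : ℝ) (k : Fin (n + 1))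
    (x : Fin (n + 1) → α) : ℝ :=
  1 / (2 * ((n : ℝ) + 1)) * (estInvolved f k x + ∑ j, ∑ p, 2 * e * |estDiff f j p x|)

theorem varEstimator_sub_le (he0 : 0 ≤ e) (he : ∀ k l : Fin n, l ≠ k → ∀ x z z' y y',
      |partialDiff l z z' (partialDiff k y y' f) x| ≤ e)
    (k : Fin (n + 1)) (x : Fin (n + 1) → α) (y : α) :
    varEstimator f x - varEstimator f (Function.update x k y) ≤ estBound f e k x := by
  rw [varEstimator_eq, varEstimator_eq, estBound, estInvolved, ← mul_sub]
  refine mul_le_mul_of_nonneg_left ?_ (by positivity)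
  simp only [← Finset.sum_sub_distrib, ← Finset.sum_add_distrib]
  refine Finset.sum_le_sum fun j _ => Finset.sum_le_sum fun p _ => ?_
  have h0 : 0 ≤ 2 * e * |estDiff f j p x| := by positivity
  have h1 := sq_nonneg (estDiff f j p (Function.update x k y))
  by_cases hkj : k = j
  · rw [if_pos hkj]
    have h2 : 0 ≤ if k = j.succAbove p then estDiff f j p x ^ 2 else 0 := by positivity
    linarith
  by_cases hkp : k = j.succAbove p
  · rw [if_neg hkj, if_pos hkp]
    linarith
  rw [if_neg hkj, if_neg hkp]
  have h3 := abs_estDiff_sub_update_le he hkj hkp x y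
  have h4 : estDiff f j p x * (estDiff f j p x - estDiff f j p (Function.update x k y)) ≤
      |estDiff f j p x| * e :=
    (le_abs_self _).trans (by rw [abs_mul]; exact mul_le_mul_of_nonneg_left h3 (abs_nonneg _))
  nlinarith [sq_nonneg (estDiff f j p x - estDiff f j p (Function.update x k y))]

theorem estInvolved_nonneg (f : (Fin n → α) → ℝ) (k : Fin (n + 1)) (x : Fin (n + 1) → α) :
    0 ≤ estInvolved f k x :=
  Finset.sum_nonneg fun j _ => Finset.sum_nonneg fun p _ => by positivity

/-- Every difference involves exactly two coordinates. -/
theorem sum_estInvolved (f : (Fin n → α) → ℝ) (x : Fin (n + 1) → α) :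
    ∑ k, estInvolved f k x = 2 * ∑ j, ∑ p, estDiff f j p x ^ 2 := by
  simp only [estInvolved]
  rw [Finset.sum_comm, Finset.mul_sum]
  refine Finset.sum_congr rfl fun j _ => ?_
  rw [Finset.sum_comm, Finset.mul_sum]
  refine Finset.sum_congr rfl fun p _ => ?_
  rw [Finset.sum_add_distrib]
  simp [two_mul]

/-- Every coordinate is involved in few differences. -/
theorem estInvolved_le (hM : ∀ k x y y', partialDiff k y y' f x ≤ M) (k : Fin (n + 1))
    (x : Fin (n + 1) → α) : estInvolved f k x ≤ 2 * ((n : ℝ) + 1) * M ^ 2 := by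
  have hd : ∀ j p, estDiff f j p x ^ 2 ≤ M ^ 2 := fun j p =>
    sq_le_sq' (neg_le_of_abs_le (abs_estDiff_le hM j p x))
      (le_of_abs_le (abs_estDiff_le hM j p x))
  have h1 : ∑ j, ∑ p, (if k = j then estDiff f j p x ^ 2 else 0) ≤ ((n : ℝ) + 1) * M ^ 2 := by
    rw [Finset.sum_comm]
    calc ∑ p, ∑ j, (if k = j then estDiff f j p x ^ 2 else 0)
        = ∑ p, estDiff f k p x ^ 2 := by simp
      _ ≤ ∑ _p : Fin n, M ^ 2 := Finset.sum_le_sum fun p _ => hd k p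
      _ ≤ _ := by
        simp only [Finset.sum_const, Finset.card_univ, Fintype.card_fin, nsmul_eq_mul]
        nlinarith [sq_nonneg M]
  have h2 : ∑ j : Fin (n + 1), ∑ p, (if k = j.succAbove p then estDiff f j p x ^ 2 else 0) ≤
      ((n : ℝ) + 1) * M ^ 2 := by
    calc ∑ j : Fin (n + 1), ∑ p, (if k = j.succAbove p then estDiff f j p x ^ 2 else 0)
        ≤ ∑ _j : Fin (n + 1), M ^ 2 := by
          refine Finset.sum_le_sum fun j _ => ?_
          by_cases hkj : k = j
          · subst hkj
            have : ∀ p : Fin n, k ≠ k.succAbove p := fun p => (Fin.succAbove_ne k p).symm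
            simp [this, sq_nonneg]
          · obtain ⟨q, rfl⟩ := Fin.exists_succAbove_eq hkj
            simpa [Fin.succAbove_right_inj] using hd j q
      _ = _ := by simp
  calc estInvolved f k x = _ + _ := by simp only [estInvolved, Finset.sum_add_distrib]
    _ ≤ _ := add_le_add h1 h2
    _ = _ := by ring

/-- The total contribution of the differences not involving the changed coordinate, by the
Cauchy–Schwarz inequality. -/
theorem sq_sum_abs_estDiff_le (f : (Fin n → α) → ℝ) (x : Fin (n + 1) → α) :
    (∑ j, ∑ p, |estDiff f j p x|) ^ 2 ≤
      ((n : ℝ) + 1) * n * ∑ j, ∑ p, estDiff f j p x ^ 2 := by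
  rw [← Fintype.sum_prod_type', ← Fintype.sum_prod_type']
  refine sq_sum_le_card_mul_sum_sq.trans (le_of_eq ?_)
  simp

theorem sum_abs_estDiff_le (hM : ∀ k x y y', partialDiff k y y' f x ≤ M) (x : Fin (n + 1) → α) :
    ∑ j, ∑ p, |estDiff f j p x| ≤ ((n : ℝ) + 1) * n * M := by
  refine (Finset.sum_le_sum fun j _ => Finset.sum_le_sum fun p _ =>
    abs_estDiff_le hM j p x).trans (le_of_eq ?_)
  simp [mul_assoc]

theorem estBound_eq (f : (Fin n → α) → ℝ) (e : ℝ) (k : Fin (n + 1)) (x : Fin (n + 1) → α) :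
    estBound f e k x = estInvolved f k x / (2 * ((n : ℝ) + 1)) +
      e * (∑ j, ∑ p, |estDiff f j p x|) / ((n : ℝ) + 1) := by
  simp only [estBound, ← Finset.mul_sum]
  field_simp

variable [MeasurableSpace α]

theorem bddMeas_estDiff (hf : BddMeas f) (j : Fin (n + 1)) (p : Fin n) :
    BddMeas (estDiff f j p) := by
  have h : Measurable (fun x : Fin (n + 1) → α => j.removeNth x) :=
    measurable_pi_lambda _ fun i => measurable_pi_apply _
  exact (hf.comp h).sub ((hf.update p).comp (h.prodMk (measurable_pi_apply j)))

theorem bddMeas_varEstimator (hf : BddMeas f) : BddMeas (varEstimator f) := by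
  rw [funext (varEstimator_eq f)]
  exact (BddMeas.sum fun j => BddMeas.sum fun p => (bddMeas_estDiff hf j p).sq).const_mul _

theorem bddMeas_estInvolved (hf : BddMeas f) (k : Fin (n + 1)) :
    BddMeas (estInvolved f k) := by
  refine BddMeas.sum fun j => BddMeas.sum fun p => ?_
  refine BddMeas.add ?_ ?_
  · split_ifs
    exacts [(bddMeas_estDiff hf j p).sq, BddMeas.const 0]
  · split_ifs
    exacts [(bddMeas_estDiff hf j p).sq, BddMeas.const 0]

/-- After normalization the variance estimator is self-bounding with constant one. -/
theorem selfBounding_varEstimator (hf : BddMeas f) (hn : 1 ≤ n) (hM0 : 0 < M)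
    (hM : ∀ k x y y', partialDiff k y y' f x ≤ M) (he0 : 0 ≤ e)
    (he : ∀ k l : Fin n, l ≠ k → ∀ x z z' y y',
      |partialDiff l z z' (partialDiff k y y' f) x| ≤ e) {J : ℝ} (hJ : n * e ≤ J) :
    SelfBounding 1 (fun x => varEstimator f x / (2 * (M + 2 * J) ^ 2))
        (fun k x => estBound f e k x / (2 * (M + 2 * J) ^ 2)) ∧
      ∀ k x, estBound f e k x / (2 * (M + 2 * J) ^ 2) ≤ 1 := by
  have hJ0 : 0 ≤ J := (by positivity : 0 ≤ n * e).trans hJ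
  have hn' : (1 : ℝ) ≤ n := by exact_mod_cast hn
  have hc : 0 < 2 * (M + 2 * J) ^ 2 := by positivity
  have hnonneg : ∀ k x, 0 ≤ estBound f e k x := fun k x =>
    mul_nonneg (by positivity) (add_nonneg (estInvolved_nonneg f k x)
      (Finset.sum_nonneg fun j _ => Finset.sum_nonneg fun p _ => by positivity))
  have hA : ∀ k x, estInvolved f k x / (2 * ((n : ℝ) + 1)) ≤ M ^ 2 := fun k x => by
    rw [div_le_iff₀ (by positivity)]
    linarith [estInvolved_le hM k x]
  have hB : ∀ x, e * (∑ j, ∑ p, |estDiff f j p x|) / ((n : ℝ) + 1) ≤ J * M := fun x => by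
    rw [div_le_iff₀ (by positivity)]
    have h1 := mul_le_mul_of_nonneg_left (sum_abs_estDiff_le hM x) he0
    have h2 := mul_le_mul_of_nonneg_right hJ (by positivity : 0 ≤ M * ((n : ℝ) + 1))
    linarith
  have hsum : ∀ x, ∑ k, estBound f e k x ^ 2 ≤ 2 * (M + 2 * J) ^ 2 * varEstimator f x := by
    intro x
    have hv := varEstimator_eq f x
    have hv0 := varEstimator_nonneg f x
    set v := varEstimator f x
    set Q := ∑ j, ∑ p, estDiff f j p x ^ 2
    set B := e * (∑ j, ∑ p, |estDiff f j p x|) / ((n : ℝ) + 1) with hB_def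
    have hB0 : 0 ≤ B := by positivity
    have hQ : Q = 2 * ((n : ℝ) + 1) * v := by rw [hv]; field_simp
    have hA0 : ∀ k, 0 ≤ estInvolved f k x / (2 * ((n : ℝ) + 1)) := fun k =>
      div_nonneg (estInvolved_nonneg f k x) (by positivity)
    have hsA : ∑ k, estInvolved f k x / (2 * ((n : ℝ) + 1)) = 2 * v := by
      rw [← Finset.sum_div, sum_estInvolved]
      change 2 * Q / _ = _
      rw [hQ]
      field_simp
    have hsA2 : ∑ k, (estInvolved f k x / (2 * ((n : ℝ) + 1))) ^ 2 ≤ M ^ 2 * (2 * v) := by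
      rw [← hsA, Finset.mul_sum]
      refine Finset.sum_le_sum fun k _ => ?_
      rw [pow_two]
      exact mul_le_mul_of_nonneg_right (hA k x) (hA0 k)
    have hsB2 : ((n : ℝ) + 1) * B ^ 2 ≤ 4 * J ^ 2 * v := by
      have h1 := mul_le_mul_of_nonneg_left (sq_sum_abs_estDiff_le f x) (sq_nonneg e)
      have h2 : ((n : ℝ) + 1) * B ^ 2 =
          e ^ 2 * (∑ j, ∑ p, |estDiff f j p x|) ^ 2 / ((n : ℝ) + 1) := by
        rw [hB_def]; field_simp
      have h3 : ((n : ℝ) + 1) * B ^ 2 ≤ e ^ 2 * n * Q := by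
        rw [h2, div_le_iff₀ (by positivity)]
        linarith
      have h4 : (n * e) ^ 2 ≤ J ^ 2 := pow_le_pow_left₀ (by positivity) hJ 2
      -- this step uses `n + 1 ≤ 2 * n`
      have h5 : e ^ 2 * n * Q ≤ 4 * (n * e) ^ 2 * v := by
        rw [hQ]
        have : 0 ≤ 2 * (e ^ 2 * n * v) * ((n : ℝ) - 1) :=
          mul_nonneg (by positivity) (by linarith)
        linarith
      nlinarith
    have hexpand : ∑ k, estBound f e k x ^ 2 =
        ∑ k, (estInvolved f k x / (2 * ((n : ℝ) + 1))) ^ 2 +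
          2 * B * ∑ k, estInvolved f k x / (2 * ((n : ℝ) + 1)) + ((n : ℝ) + 1) * B ^ 2 := by
      have hk : ∀ k, estBound f e k x = estInvolved f k x / (2 * ((n : ℝ) + 1)) + B := fun k =>
        estBound_eq f e k x
      simp only [hk, add_sq, Finset.sum_add_distrib, Finset.sum_const, Finset.card_univ,
        Fintype.card_fin, nsmul_eq_mul]
      rw [Finset.mul_sum]
      push_cast
      congr 2
      exact Finset.sum_congr rfl fun k _ => by ring
    rw [hexpand, hsA]
    have h6 : 2 * B * (2 * v) ≤ 4 * (J * M) * v := by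
      nlinarith [mul_le_mul_of_nonneg_right (hB x) hv0]
    have h7 : 0 ≤ J * M * v := by positivity
    have h8 : 0 ≤ J ^ 2 * v := by positivity
    nlinarith
  refine ⟨⟨?_, fun k => ?_, fun k x => div_nonneg (hnonneg k x) hc.le, fun k x y => ?_,
    fun x => ?_⟩, fun k x => ?_⟩
  · simpa only [div_eq_inv_mul] using (bddMeas_varEstimator hf).const_mul _
  · simp only [div_eq_inv_mul]
    exact (((bddMeas_estInvolved hf k).add (BddMeas.sum fun j => BddMeas.sum fun p =>
      (bddMeas_estDiff hf j p).abs.const_mul _)).const_mul _).const_mul _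
  · rw [← sub_div]
    exact div_le_div_of_nonneg_right (varEstimator_sub_le he0 he k x y) hc.le
  · simp only [div_pow]
    rw [← Finset.sum_div, one_mul, div_le_div_iff₀ (by positivity) hc]
    nlinarith [mul_le_mul_of_nonneg_right (hsum x) hc.le]
  · rw [div_le_one hc, estBound_eq]
    have h1 := hA k x
    have h2 := hB x
    have h3 : 0 ≤ J * M := by positivity
    nlinarith [sq_nonneg J, sq_nonneg M]

theorem integral_integral_sq_sub {X : α → ℝ} (hX : BddMeas X) (μ : Measure α)
    [IsProbabilityMeasure μ] :
    ∫ y', ∫ y, (X y' - X y) ^ 2 ∂μ ∂μ = 2 * ∫ y, (X y - ∫ y', X y' ∂μ) ^ 2 ∂μ := by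
  set c := ∫ y', X y' ∂μ with hc
  have hX' : BddMeas (fun y => X y - c) := hX.sub (BddMeas.const c)
  have hc0 : ∫ y, (X y - c) ∂μ = 0 := by
    rw [integral_sub (hX.integrable μ) (integrable_const _)]
    simp [hc]
  have h1 : ∀ y', ∫ y, (X y' - X y) ^ 2 ∂μ = (X y' - c) ^ 2 + ∫ y, (X y - c) ^ 2 ∂μ := by
    intro y'
    have h2 : ∀ y, (X y' - X y) ^ 2 =
        (X y' - c) ^ 2 - 2 * (X y' - c) * (X y - c) + (X y - c) ^ 2 := fun y => by ring
    simp_rw [h2]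
    rw [integral_add (((BddMeas.const _).sub (hX'.const_mul _)).integrable μ)
        (hX'.sq.integrable μ),
      integral_sub (integrable_const _) ((hX'.const_mul _).integrable μ), integral_const_mul, hc0]
    simp
  simp_rw [h1]
  rw [integral_add (hX'.sq.integrable μ) (integrable_const _)]
  simp only [integral_const, probReal_univ, smul_eq_mul, one_mul]
  ring

theorem measurePreserving_removeNth_prodMk (μ : Measure α) [IsProbabilityMeasure μ]
    (j : Fin (n + 1)) :
    MeasurePreserving (fun x : Fin (n + 1) → α => (j.removeNth x, x j))
      (Measure.pi fun _ : Fin (n + 1) => μ) ((Measure.pi fun _ : Fin n => μ).prod μ) :=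
  (Measure.measurePreserving_swap).comp
    (measurePreserving_piFinSuccAbove (fun _ : Fin (n + 1) => μ) j)

/-- The variance estimator is an unbiased estimator of the expected sum of the conditional
variances. -/
theorem integral_varEstimator (hf : BddMeas f) (μ : Measure α) [IsProbabilityMeasure μ] :
    ∫ x, varEstimator f x ∂(Measure.pi fun _ => μ) =
      ∫ x, sumCondVar μ f x ∂(Measure.pi fun _ => μ) := by
  have hd : ∀ j p, ∫ x, estDiff f j p x ^ 2 ∂(Measure.pi fun _ : Fin (n + 1) => μ) =
      2 * ∫ x, condVar μ f p x ∂(Measure.pi fun _ => μ) := by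
    intro j p
    have hG : BddMeas (fun z : (Fin n → α) × α => (f z.1 - f (Function.update z.1 p z.2)) ^ 2) :=
      ((hf.comp measurable_fst).sub (hf.update p)).sq
    have hT := measurePreserving_removeNth_prodMk (n := n) μ j
    have h1 : ∫ x, estDiff f j p x ^ 2 ∂(Measure.pi fun _ : Fin (n + 1) => μ) =
        ∫ z, (f z.1 - f (Function.update z.1 p z.2)) ^ 2
          ∂((Measure.pi fun _ : Fin n => μ).prod μ) := by
      rw [← hT.map_eq, integral_map hT.measurable.aemeasurable hG.meas.aestronglyMeasurable]
      rfl
    rw [h1, integral_prod _ (hG.integrable _),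
      ← integral_integral_update μ p (hG.integral_right μ), ← integral_const_mul]
    refine integral_congr_ae (Filter.Eventually.of_forall fun x => ?_)
    simp only [Function.update_idem]
    exact integral_integral_sq_sub ((hf.update p).comp measurable_prodMk_left) μ
  rw [funext (varEstimator_eq f), integral_const_mul,
    integral_finsetSum _ fun j _ =>
      (BddMeas.sum fun p => (bddMeas_estDiff hf j p).sq).integrable _]
  have h2 : ∀ j, ∫ x, ∑ p, estDiff f j p x ^ 2 ∂(Measure.pi fun _ : Fin (n + 1) => μ) =
      2 * ∫ x, sumCondVar μ f x ∂(Measure.pi fun _ => μ) := fun j => by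
    simp only [sumCondVar]
    rw [integral_finsetSum _ fun p _ => (bddMeas_estDiff hf j p).sq.integrable _,
      integral_finsetSum _ fun p _ => (bddMeas_condVar hf μ p).integrable _, Finset.mul_sum]
    exact Finset.sum_congr rfl fun p _ => hd j p
  simp only [h2, Finset.sum_const, Finset.card_univ, Fintype.card_fin, nsmul_eq_mul]
  push_cast
  field_simp

end Estimator

/-! ### The empirical Bernstein inequality -/

section Main

variable {α : Type*} {n : ℕ} {f : (Fin n → α) → ℝ}

theorem eq_of_partialDiff_nonpos (h : ∀ k x y y', partialDiff k y y' f x ≤ 0)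
    (x x' : Fin n → α) : f x' = f x := by
  have hup : ∀ k (z : Fin n → α) y, f (Function.update z k y) = f z := fun k z y => by
    have h1 := abs_partialDiff_le h k z y (z k)
    simp only [partialDiff, Function.update_eq_self] at h1
    linarith [abs_nonpos_iff.1 h1]
  have hs : ∀ s : Finset (Fin n), f (s.piecewise x' x) = f x := by
    intro s
    induction s using Finset.induction_on with
    | empty => simp
    | insert k s _ ih => rw [Finset.piecewise_insert, hup, ih]
  simpa using hs Finset.univ

theorem partialDiff_le_seminormM (hf : ∃ C : ℝ, ∀ x, |f x| ≤ C) (k : Fin n) (x : Fin n → α)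
    (y y' : α) : partialDiff k y y' f x ≤ seminormM f := by
  obtain ⟨C, hC⟩ := hf
  have hb : BddAbove (Set.range fun q : (Fin n → α) × α × α =>
      partialDiff k q.2.1 q.2.2 f q.1) := by
    refine ⟨C + C, ?_⟩
    rintro _ ⟨q, rfl⟩
    exact (le_abs_self _).trans ((abs_sub _ _).trans (add_le_add (hC _) (hC _)))
  exact (le_ciSup hb (x, y, y')).trans
    (le_ciSup (f := fun k : Fin n => ⨆ q : (Fin n → α) × α × α,
      partialDiff k q.2.1 q.2.2 f q.1) (Set.finite_range _).bddAbove k)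

/-- The mixed second differences of `f` are bounded by `e` with `n * e ≤ seminormJ f`. -/
theorem exists_partialDiff_partialDiff_le [Nonempty α] (hf : ∃ C : ℝ, ∀ x, |f x| ≤ C) :
    ∃ e : ℝ, 0 ≤ e ∧ n * e ≤ seminormJ f ∧ ∀ k l : Fin n, l ≠ k → ∀ x z z' y y',
      |partialDiff l z z' (partialDiff k y y' f) x| ≤ e := by
  obtain ⟨C, hC⟩ := hf
  have hb : ∀ p : {p : Fin n × Fin n // p.1 ≠ p.2}, BddAbove (Set.range
      fun q : (Fin n → α) × (α × α) × (α × α) =>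
        partialDiff p.1.1 q.2.1.1 q.2.1.2 (partialDiff p.1.2 q.2.2.1 q.2.2.2 f) q.1) := by
    refine fun p => ⟨(C + C) + (C + C), ?_⟩
    rintro _ ⟨q, rfl⟩
    exact (le_abs_self _).trans ((abs_sub _ _).trans (add_le_add
      ((abs_sub _ _).trans (add_le_add (hC _) (hC _)))
      ((abs_sub _ _).trans (add_le_add (hC _) (hC _)))))
  have hle : ∀ (p : {p : Fin n × Fin n // p.1 ≠ p.2}) (q : (Fin n → α) × (α × α) × (α × α)),
      partialDiff p.1.1 q.2.1.1 q.2.1.2 (partialDiff p.1.2 q.2.2.1 q.2.2.2 f) q.1 ≤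
      ⨆ p : {p : Fin n × Fin n // p.1 ≠ p.2}, ⨆ q : (Fin n → α) × (α × α) × (α × α),
        partialDiff p.1.1 q.2.1.1 q.2.1.2 (partialDiff p.1.2 q.2.2.1 q.2.2.2 f) q.1 :=
    fun p q => (le_ciSup (hb p) q).trans
      (le_ciSup (f := fun p : {p : Fin n × Fin n // p.1 ≠ p.2} =>
        ⨆ q : (Fin n → α) × (α × α) × (α × α),
          partialDiff p.1.1 q.2.1.1 q.2.1.2 (partialDiff p.1.2 q.2.2.1 q.2.2.2 f) q.1)
        (Set.finite_range _).bddAbove p)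
  refine ⟨_, ?_, le_rfl, fun k l hlk x z z' y y' => abs_le.2 ⟨?_, ?_⟩⟩
  · rcases isEmpty_or_nonempty {p : Fin n × Fin n // p.1 ≠ p.2} with hp | ⟨⟨p⟩⟩
    · rw [Real.iSup_of_isEmpty]
    · obtain ⟨y⟩ := ‹Nonempty α›
      simpa [partialDiff] using hle p (fun _ => y, (y, y), (y, y))
  · have h1 := hle ⟨(l, k), hlk⟩ (x, (z', z), (y, y'))
    rw [neg_le]
    refine le_trans (le_of_eq ?_) h1
    simp only [partialDiff]
    ring
  · exact hle ⟨(l, k), hlk⟩ (x, (z, z'), (y, y'))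

variable [MeasurableSpace α]

/-- The empirical Bernstein inequality for a product measure, with the random sample as the
coordinates. The sample of size `n` omits the last coordinate. -/
theorem measure_empirical_bernstein (μ : Measure α) [IsProbabilityMeasure μ] (hf : BddMeas f)
    (hn : 1 ≤ n) {M J e : ℝ} (hM0 : 0 < M) (hM : ∀ k x y y', partialDiff k y y' f x ≤ M)
    (he0 : 0 ≤ e) (he : ∀ k l : Fin n, l ≠ k → ∀ x z z' y y',
      |partialDiff l z z' (partialDiff k y y' f) x| ≤ e) (hJ : n * e ≤ J) {L : ℝ} (hL : 0 < L) :
    1 - 2 * Real.exp (-L) ≤ (Measure.pi fun _ : Fin (n + 1) => μ).real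
      {x | f (fun i => x i.castSucc) ≤
        ∫ z : Fin (n + 1) → α, f (fun i => z i.castSucc) ∂(Measure.pi fun _ => μ) +
          √(2 * varEstimator f x * L) + (8 * M / 3 + 5 * J) * L} := by
  set π' := Measure.pi fun _ : Fin (n + 1) => μ
  have hJ0 : 0 ≤ J := (by positivity : 0 ≤ n * e).trans hJ
  set V := ∫ x, sumCondVar μ f x ∂(Measure.pi fun _ : Fin n => μ) with hV
  have hT : MeasurePreserving (fun (x : Fin (n + 1) → α) (i : Fin n) => x i.castSucc) π'
      (Measure.pi fun _ : Fin n => μ) := by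
    have := (measurePreserving_fst (μ := Measure.pi fun _ : Fin n => μ) (ν := μ)).comp
      (measurePreserving_removeNth_prodMk (n := n) μ (Fin.last n))
    simp only [Function.comp_def, Fin.removeNth_last] at this
    exact this
  have hE : ∫ z : Fin (n + 1) → α, f (fun i => z i.castSucc) ∂π' =
      ∫ x, f x ∂(Measure.pi fun _ => μ) := by
    rw [← hT.map_eq, integral_map hT.measurable.aemeasurable hf.meas.aestronglyMeasurable]
  rw [hE]
  set m := ∫ x, f x ∂(Measure.pi fun _ : Fin n => μ)
  -- the tail of `f` around its expectation
  have hA := measure_bernstein_le μ hf hM0.le hM he0 he (J := J + M / 6) (γ := 2 * M / 3 + J)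
    (by positivity) (by linarith) (by linarith) hL
  set A := {x : Fin n → α | m + √(2 * V * L) + (2 * M / 3 + J) * L < f x} with hA_def
  have hAm : MeasurableSet A := measurableSet_lt measurable_const hf.meas
  rw [← hT.measureReal_preimage hAm.nullMeasurableSet] at hA
  -- the lower tail of the variance estimator
  obtain ⟨hsb, hr1⟩ := selfBounding_varEstimator hf hn hM0 hM he0 he hJ
  have hB := hsb.measure_sqrt_add_lt_le hr1 μ hL.le
  rw [integral_div, integral_varEstimator hf μ, ← hV] at hB
  set B := {x : Fin (n + 1) → α | √(varEstimator f x / (2 * (M + 2 * J) ^ 2)) + √L <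
    √(V / (2 * (M + 2 * J) ^ 2))} with hB_def
  set G := {x : Fin (n + 1) → α | f (fun i => x i.castSucc) ≤ m +
    √(2 * varEstimator f x * L) + (8 * M / 3 + 5 * J) * L} with hG_def
  set T := fun (x : Fin (n + 1) → α) (i : Fin n) => x i.castSucc
  have hcover : Set.univ ⊆ G ∪ (T ⁻¹' A ∪ B) := by
    intro x _
    by_cases hxA : x ∈ T ⁻¹' A
    · exact Or.inr (Or.inl hxA)
    by_cases hxB : x ∈ B
    · exact Or.inr (Or.inr hxB)
    refine Or.inl ?_
    have h1 : f (T x) ≤ m + √(2 * V * L) + (2 * M / 3 + J) * L := not_lt.1 hxA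
    have h2 : √(V / (2 * (M + 2 * J) ^ 2)) ≤
      √(varEstimator f x / (2 * (M + 2 * J) ^ 2)) + √L := not_lt.1 hxB
    have hv0 := varEstimator_nonneg f x
    change f (T x) ≤ m + √(2 * varEstimator f x * L) + (8 * M / 3 + 5 * J) * L
    set v := varEstimator f x
    have hs2 : √2 * √2 = 2 := Real.mul_self_sqrt (by norm_num)
    have hsL : √L * √L = L := Real.mul_self_sqrt hL.le
    have hc0 : 0 < √2 * (M + 2 * J) := by positivity
    have hroot : √(2 * (M + 2 * J) ^ 2) = √2 * (M + 2 * J) := by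
      rw [Real.sqrt_mul (by norm_num), Real.sqrt_sq (by positivity)]
    rw [Real.sqrt_div' _ (by positivity), Real.sqrt_div' _ (by positivity), hroot,
      div_add' _ _ _ hc0.ne', div_le_div_iff_of_pos_right hc0] at h2
    have h3 : √(2 * V * L) ≤ √(2 * v * L) + 2 * (M + 2 * J) * L := by
      rw [Real.sqrt_mul' _ hL.le, Real.sqrt_mul (by norm_num), Real.sqrt_mul' _ hL.le,
        Real.sqrt_mul (by norm_num)]
      have h4 := mul_le_mul_of_nonneg_left h2 (by positivity : 0 ≤ √2 * √L)
      have h5 : √2 * √L * (√v + √L * (√2 * (M + 2 * J))) =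
          √2 * √v * √L + 2 * (M + 2 * J) * L := by
        linear_combination (M + 2 * J) * (√L * √L) * hs2 + 2 * (M + 2 * J) * hsL
      linarith
    linarith
  have hunion : (1 : ℝ) ≤ π'.real G + (π'.real (T ⁻¹' A) + π'.real B) := by
    calc (1 : ℝ) = π'.real Set.univ := by simp
      _ ≤ π'.real (G ∪ (T ⁻¹' A ∪ B)) := measureReal_mono hcover
      _ ≤ π'.real G + π'.real (T ⁻¹' A ∪ B) := measureReal_union_le _ _
      _ ≤ _ := by gcongr; exact measureReal_union_le _ _
  linarith

end Main

end WeakInteractions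

theorem theorem5 {Ω 𝒳 : Type*} [MeasurableSpace Ω] [MeasurableSpace 𝒳]
    (P : Measure Ω) [IsProbabilityMeasure P]
    (n : ℕ) (hn : 1 ≤ n) (X : Fin (n + 1) → Ω → 𝒳)
    (hX : ∀ i, Measurable (X i)) (hindep : iIndepFun X P)
    (hident : ∀ i j, IdentDistrib (X i) (X j) P P)
    (f : (Fin n → 𝒳) → ℝ) (hf : Measurable f) (hbdd : ∃ C : ℝ, ∀ x, |f x| ≤ C)
    (a b : ℝ) (hweak : WeakInteractions.HasWeakInteractions a b f)
    (δ : ℝ) (hδ : 0 < δ) :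
    1 - δ ≤ P.real {ω | f (fun i : Fin n => X i.castSucc ω) ≤
      (∫ ω', f (fun i : Fin n => X i.castSucc ω') ∂P)
        + Real.sqrt (2 * WeakInteractions.varEstimator f (fun i => X i ω) * Real.log (2 / δ))
        + (8 * a / 3 + 5 * b) * Real.log (2 / δ) / n} := by
  rcases le_or_gt 1 δ with hδ1 | hδ1
  · exact (sub_nonpos.2 hδ1).trans measureReal_nonneg
  have hL : 0 < Real.log (2 / δ) := Real.log_pos (by rw [lt_div_iff₀ hδ]; linarith)
  set L := Real.log (2 / δ) with hL_def
  have hexpL : Real.exp (-L) = δ / 2 := by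
    rw [Real.exp_neg, hL_def, Real.exp_log (by positivity), inv_div]
  have hn0 : (0 : ℝ) < n := by exact_mod_cast hn
  set μ := P.map (X 0) with hμ
  have : IsProbabilityMeasure μ := Measure.isProbabilityMeasure_map (hX 0).aemeasurable
  have : Nonempty 𝒳 := nonempty_of_isProbabilityMeasure μ
  have hbm : WeakInteractions.BddMeas f := ⟨hf, hbdd⟩
  obtain ⟨hwM, hwJ⟩ := hweak
  have hM : ∀ k x y y', WeakInteractions.partialDiff k y y' f x ≤ a / n := fun k x y y' =>
    (WeakInteractions.partialDiff_le_seminormM hbdd k x y y').trans hwM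
  obtain ⟨e, he0, heJ, he⟩ := WeakInteractions.exists_partialDiff_partialDiff_le hbdd
  have hJ : n * e ≤ b / n := heJ.trans hwJ
  have hb0 : 0 ≤ b / n := (by positivity : 0 ≤ n * e).trans hJ
  have hM0 : 0 ≤ a / n := by
    obtain ⟨y⟩ := ‹Nonempty 𝒳›
    simpa [WeakInteractions.partialDiff] using hM ⟨0, hn⟩ (fun _ => y) y y
  have hrem : (8 * a / 3 + 5 * b) * L / n = (8 * (a / n) / 3 + 5 * (b / n)) * L := by ring
  rw [hrem]
  rcases hM0.eq_or_lt with hM0 | hM0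
  · -- a function without first differences is constant
    have hconst : ∀ x x', f x' = f x :=
      WeakInteractions.eq_of_partialDiff_nonpos fun k x y y' => (hM k x y y').trans hM0.symm.le
    have huniv : {ω | f (fun i : Fin n => X i.castSucc ω) ≤
        (∫ ω', f (fun i : Fin n => X i.castSucc ω') ∂P)
          + √(2 * WeakInteractions.varEstimator f (fun i => X i ω) * L)
          + (8 * (a / n) / 3 + 5 * (b / n)) * L} = Set.univ := by
      refine Set.eq_univ_of_forall fun ω => ?_
      have h1 : ∫ ω', f (fun i : Fin n => X i.castSucc ω') ∂P =
          f (fun i : Fin n => X i.castSucc ω) := by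
        rw [integral_congr_ae (Filter.Eventually.of_forall fun ω' =>
          hconst (fun i : Fin n => X i.castSucc ω) (fun i : Fin n => X i.castSucc ω'))]
        simp
      have h2 : 0 ≤ (8 * (a / n) / 3 + 5 * (b / n)) * L := by rw [← hM0]; positivity
      have h3 := Real.sqrt_nonneg (2 * WeakInteractions.varEstimator f (fun i => X i ω) * L)
      change f (fun i : Fin n => X i.castSucc ω) ≤ _
      rw [h1]
      linarith
    rw [huniv, probReal_univ]
    linarith
  -- the sample is distributed according to the product measure
  have hmeas : Measurable (fun ω i => X i ω) := measurable_pi_lambda _ hX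
  have hlaw : P.map (fun ω i => X i ω) = Measure.pi fun _ : Fin (n + 1) => μ := by
    rw [(iIndepFun_iff_map_fun_eq_pi_map fun i => (hX i).aemeasurable).1 hindep]
    congr 1
    ext1 i
    exact (hident i 0).map_eq
  have hmp : MeasurePreserving (fun ω i => X i ω) P (Measure.pi fun _ : Fin (n + 1) => μ) :=
    ⟨hmeas, hlaw⟩
  have key := WeakInteractions.measure_empirical_bernstein μ hbm hn hM0 hM he0 he hJ hL
  have hT : Measurable (fun (x : Fin (n + 1) → 𝒳) (i : Fin n) => x i.castSucc) :=
    measurable_pi_lambda _ fun i => measurable_pi_apply _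
  have hE : ∫ z : Fin (n + 1) → 𝒳, f (fun i => z i.castSucc) ∂(Measure.pi fun _ => μ) =
      ∫ ω', f (fun i : Fin n => X i.castSucc ω') ∂P := by
    rw [← hmp.map_eq, integral_map hmeas.aemeasurable
      (f := fun z => f (fun i => z i.castSucc)) (hf.comp hT).aestronglyMeasurable]
  rw [hE] at key
  have hset : MeasurableSet {x : Fin (n + 1) → 𝒳 | f (fun i => x i.castSucc) ≤
      ∫ ω', f (fun i : Fin n => X i.castSucc ω') ∂P +
        √(2 * WeakInteractions.varEstimator f x * L) + (8 * (a / n) / 3 + 5 * (b / n)) * L} :=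
    measurableSet_le (hf.comp hT) ((((WeakInteractions.bddMeas_varEstimator hbm).const_mul 2).meas
      |>.mul_const L |>.sqrt |>.const_add _).add_const _)
  rw [← hmp.measureReal_preimage hset.nullMeasurableSet, hexpL] at key
  calc 1 - δ = 1 - 2 * (δ / 2) := by ring
    _ ≤ _ := key
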